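/- Let $N\ge 1$, let $H_1,\dots,H_N$ be complex separable Hilbert spaces (finite- or infinite-dimensional) with orthonormal bases $\{|k_n\rangle\}_{k_n}$ of $H_n$, and let $\psi\in H_1\otimes\cdots\otimes H_N$ (the Hilbert space tensor product). Matrix product states. Given bond dimensions $D_1,\dots,D_{N-1}\in\mathbb N_0\cup\{\infty\}$ and $D_0=D_N=1$, complex matrices $M^{(k_n)}=(M^{(k_n)}_{a,a'})_{a<D_{n-1},\,a'<D_n}$ ($1\le n\le N$, one for each basis index $k_n$), and real diagonal matrices $\Lambda^{(n)}$ with diagonal entries $\Lambda^{(n)}_{a}$, $a<D_n$ ($1\le n\le N-1$), one says that $\psi$ is the matrix product state (MPS) with these data if $$\psi=\sum_{k_1,\dots,k_N}c_{k_1,\dots,k_N}\,|k_1,\dots,k_N\rangle,\qquad c_{k_1,\dots,k_N}=\sum_{a_1<D_1}\cdots\sum_{a_{N-1}<D_{N-1}}M^{(k_1)}_{0,a_1}\Lambda^{(1)}_{a_1}M^{(k_2)}_{a_1,a_2}\Lambda^{(2)}_{a_2}\cdots\Lambda^{(N-1)}_{a_{N-1}}M^{(k_N)}_{a_{N-1},0},$$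 where the sum over $k_1,\dots,k_N$ converges in norm and all (iterated) sums over the bond indices converge in $\mathbb C$. The matrices of site $n$ are left-normalized if $\sum_{k_n}\sum_{a}\overline{M^{(k_n)}_{a,c}}\,M^{(k_n)}_{a,c'}=\delta_{cc'}$ for all $c,c'<D_n$, and right-normalized if $\sum_{k_n}\sum_{a}M^{(k_n)}_{c,a}\,\overline{M^{(k_n)}_{c',a}}=\delta_{cc'}$ for all $c,c'<D_{n-1}$. Then, for the given bases, $\psi$ can be written as an MPS in each of the following four forms (each with its own bond dimensions). 1. Left-canonical: all $\Lambda^{(n)}$ are identity matrices and the matrices of the sites $1,\dots,N-1$ are left-normalized; if $\|\psi\|=1$, so are those of site $N$. 2. Right-canonical: all $\Lambda^{(n)}$ are identity matrices and the matrices of the sites $2,\dots,N$ are right-normalized; if $\|\psi\|=1$, so are those of site $1$. 3. Mixed-canonical, for every $n\in\{1,\dots,N-1\}$: $\Lambda^{(j)}$ is the identity for $j\ne n$, $\Lambda^{(n)}$ has nonnegative entries, the matrices of the sites $1,\dots,n$ are left-normalized and those of the sites $n+1,\dots,N$ are right-normalized. 4. Canonical ($\Gamma$–$\Lambda$, Vidal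 form): writing $\Gamma$ for $M$, for every $n\in\{1,\dots,N-1\}$ the series for $$\phi_{a}=\sum_{k_1,\dots,k_n}\ \sum_{a_1,\dots,a_{n-1}}\Gamma^{(k_1)}_{0,a_1}\Lambda^{(1)}_{a_1}\cdots\Lambda^{(n-1)}_{a_{n-1}}\Gamma^{(k_n)}_{a_{n-1},a}\,|k_1,\dots,k_n\rangle,$$ $$\chi_{a}=\sum_{k_{n+1},\dots,k_N}\ \sum_{a_{n+1},\dots,a_{N-1}}\Gamma^{(k_{n+1})}_{a,a_{n+1}}\Lambda^{(n+1)}_{a_{n+1}}\cdots\Lambda^{(N-1)}_{a_{N-1}}\Gamma^{(k_N)}_{a_{N-1},0}\,|k_{n+1},\dots,k_N\rangle$$ $(a<D_n)$ converge in the same sense, and $\psi=\sum_{a<D_n}\Lambda^{(n)}_a\,\phi_a\otimes\chi_a$ is a Schmidt decomposition of $\psi\in(H_1\otimes\cdots\otimes H_n)\otimes(H_{n+1}\otimes\cdots\otimes H_N)$: the families $(\phi_a)_{a<D_n}$ and $(\chi_a)_{a<D_n}$ are orthonormal, the numbers $\Lambda^{(n)}_a$ are nonnegative and tend to $0$ if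 $D_n=\infty$, and the series converges in norm. If all $H_n$ are infinite-dimensional, then in the forms 1, 2 and 3 one can take $D_1=\cdots=D_{N-1}=\infty$. -/

import Mathlib

open scoped TensorProduct ComplexConjugate
open Filter Topology

noncomputable section

/-! ## The Hilbert space tensor product of finitely many Hilbert spaces -/

section HilbertTensorProduct

set_option linter.unusedSectionVars false

variable {ι : Type*} [Fintype ι] (H : ι → Type*)
  [∀ i, NormedAddCommGroup (H i)] [∀ i, InnerProductSpace ℂ (H i)]

/-- The algebraic tensor product `⨂ᵢ H i`. It is a type synonym of Mathlib's `PiTensorProduct`,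
so that it can carry the Hilbert space inner product and not Mathlib's projective seminorm. -/
def AlgTensor : Type _ := ⨂[ℂ] i, H i

instance : AddCommGroup (AlgTensor H) := inferInstanceAs (AddCommGroup (⨂[ℂ] i, H i))

instance : Module ℂ (AlgTensor H) := inferInstanceAs (Module ℂ (⨂[ℂ] i, H i))

namespace AlgTensor

variable {H}

/-- The elementary tensor `⨂ᵢ x i` in the algebraic tensor product. -/
def pure (x : ∀ i, H i) : AlgTensor H := PiTensorProduct.tprod ℂ x

/-- The linear functional `⨂ᵢ y i ↦ ∏ᵢ ⟪x i, y i⟫`. -/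
def bra (x : ∀ i, H i) : AlgTensor H →ₗ[ℂ] ℂ :=
  PiTensorProduct.lift
    ((MultilinearMap.mkPiAlgebra ℂ ι ℂ).compLinearMap fun i => innerₛₗ ℂ (x i))

lemma bra_pure (x y : ∀ i, H i) : bra x (pure y) = ∏ i, inner ℂ (x i) (y i) := by
  simp only [bra, pure]
  erw [PiTensorProduct.lift.tprod]
  simp

lemma hom_ext {E : Type*} [AddCommMonoid E] [Module ℂ E] {f g : AlgTensor H →ₗ[ℂ] E}
    (h : ∀ x, f (pure x) = g (pure x)) : f = g :=
  PiTensorProduct.ext (MultilinearMap.ext h)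

lemma induction {p : AlgTensor H → Prop} (t : AlgTensor H)
    (h1 : ∀ (r : ℂ) (x : ∀ i, H i), p (r • pure x))
    (h2 : ∀ s t, p s → p t → p (s + t)) : p t :=
  PiTensorProduct.induction_on t h1 h2

lemma prod_inner_update [DecidableEq ι] (x y : ∀ i, H i) (i : ι) (c : H i) :
    ∏ j, inner ℂ (Function.update x i c j) (y j)
      = inner ℂ c (y i) * ∏ j ∈ Finset.univ.erase i, inner ℂ (x j) (y j) := by
  rw [← Finset.mul_prod_erase Finset.univ _ (Finset.mem_univ i)]
  congr 1
  · simp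
  · refine Finset.prod_congr rfl fun j hj => ?_
    rw [Function.update_of_ne (Finset.ne_of_mem_erase hj)]

lemma bra_update_add [DecidableEq ι] (x : ∀ i, H i) (i : ι) (a b : H i) :
    bra (Function.update x i (a + b))
      = bra (Function.update x i a) + bra (Function.update x i b) := by
  refine hom_ext fun y => ?_
  simp only [LinearMap.add_apply, bra_pure, prod_inner_update, inner_add_left, add_mul]

lemma bra_update_smul [DecidableEq ι] (x : ∀ i, H i) (i : ι) (c : ℂ) (a : H i) :
    bra (Function.update x i (c • a)) = (starRingEnd ℂ c) • bra (Function.update x i a) := by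
  refine hom_ext fun y => ?_
  simp only [LinearMap.smul_apply, bra_pure, prod_inner_update, inner_smul_left, smul_eq_mul,
    mul_assoc]

variable (H) in
/-- The map `x ↦ (t ↦ conj (bra x t))`, which is multilinear in `x`. -/
def ketForm : MultilinearMap ℂ H (AlgTensor H →ₛₗ[starRingEnd ℂ] ℂ) where
  toFun x := (starLinearEquiv ℂ (A := ℂ)).toLinearMap.comp (bra x)
  map_update_add' := by
    intro hd x i a b
    ext t
    have := congrArg (fun f => star (f t)) (@bra_update_add _ _ _ _ _ hd x i a b)
    simp only [LinearMap.add_apply, star_add] at this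
    exact this
  map_update_smul' := by
    intro hd x i c a
    ext t
    have := congrArg (fun f => star (f t)) (@bra_update_smul _ _ _ _ _ hd x i c a)
    simp only [LinearMap.smul_apply, smul_eq_mul, star_mul', RCLike.star_def,
      Complex.conj_conj] at this
    exact this

/-- The sesquilinear form on the algebraic tensor product, linear in the first argument of this
function and conjugate-linear in the second one. -/
def form : AlgTensor H →ₗ[ℂ] AlgTensor H →ₛₗ[starRingEnd ℂ] ℂ :=
  PiTensorProduct.lift (ketForm H)

lemma form_pure (x : ∀ i, H i) (t : AlgTensor H) : form (pure x) t = conj (bra x t) := by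
  simp only [form, pure]
  erw [PiTensorProduct.lift.tprod]
  rfl

lemma form_pure_pure (x y : ∀ i, H i) :
    form (pure x) (pure y) = ∏ i, inner ℂ (y i) (x i) := by
  rw [form_pure, bra_pure, map_prod]
  simp

lemma form_conj (s t : AlgTensor H) : conj (form s t) = form t s := by
  induction s using induction with
  | h1 r x =>
    induction t using induction with
    | h1 q y =>
      simp only [map_smul, LinearMap.smul_apply, LinearMap.map_smulₛₗ, smul_eq_mul, form_pure_pure,
        map_mul, map_prod, inner_conj_symm, Complex.conj_conj]
      ring
    | h2 a b ha hb => simp only [map_add, LinearMap.add_apply, ha, hb]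
  | h2 a b ha hb => simp only [map_add, LinearMap.add_apply, ha, hb]

open scoped ComplexOrder Matrix in
lemma posSemidef_prod_gram {n : ℕ} (g : Fin n → ∀ i, H i) (s : Finset ι) :
    (Matrix.of fun j l => ∏ i ∈ s, inner ℂ (g j i) (g l i) :
      Matrix (Fin n) (Fin n) ℂ).PosSemidef := by
  classical
  induction s using Finset.induction_on with
  | empty =>
    have := Matrix.posSemidef_vecMulVec_self_star (fun _ : Fin n => (1 : ℂ))
    convert this using 1
    ext j l
    simp [Matrix.vecMulVec]
  | insert i s hi ih =>
    have key : (Matrix.of fun j l => ∏ i ∈ insert i s, inner ℂ (g j i) (g l i) :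
        Matrix (Fin n) (Fin n) ℂ) = (Matrix.gram ℂ fun j => g j i) ⊙
          Matrix.of fun j l => ∏ i ∈ s, inner ℂ (g j i) (g l i) := by
      ext j l
      simp [Matrix.gram, Finset.prod_insert hi]
    rw [key]
    exact (Matrix.posSemidef_gram ℂ (fun j => g j i)).hadamard ih

open scoped ComplexOrder Matrix in
lemma form_self_nonneg (t : AlgTensor H) : 0 ≤ (form t t).re := by
  have ht : t ∈ Submodule.span ℂ (Set.range (pure : (∀ i, H i) → AlgTensor H)) := by
    have : Submodule.span ℂ (Set.range (pure : (∀ i, H i) → AlgTensor H)) = ⊤ :=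
      PiTensorProduct.span_tprod_eq_top
    rw [this]; trivial
  obtain ⟨n, f, g, hg⟩ := Submodule.mem_span_set'.mp ht
  choose x hx using fun j => (g j).2
  have hg' : t = ∑ j, f j • pure (x j) := by
    rw [← hg]
    exact Finset.sum_congr rfl fun j _ => by rw [← hx j]
  have hP := (posSemidef_prod_gram x Finset.univ).dotProduct_mulVec_nonneg f
  have : form t t = star f ⬝ᵥ ((Matrix.of fun j l => ∏ i, inner ℂ (x j i) (x l i)) *ᵥ f) := by
    rw [hg']
    simp only [map_sum, map_smul, LinearMap.sum_apply, LinearMap.smul_apply,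
      LinearMap.map_smulₛₗ, form_pure_pure, dotProduct, Matrix.mulVec, Matrix.of_apply,
      Pi.star_apply, Finset.mul_sum, smul_eq_mul, RCLike.star_def]
    refine Finset.sum_congr rfl fun j _ => Finset.sum_congr rfl fun l _ => ?_
    ring
  rw [this]
  exact (Complex.le_def.mp hP).1

/-- The inner product on the algebraic tensor product, with
`⟪⨂ᵢ x i, ⨂ᵢ y i⟫ = ∏ᵢ ⟪x i, y i⟫`; see `inner_pure`. -/
@[reducible]
def core : PreInnerProductSpace.Core ℂ (AlgTensor H) where
  inner s t := form t s
  conj_inner_symm s t := form_conj s t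
  re_inner_nonneg := form_self_nonneg
  add_left s t u := map_add (form u) s t
  smul_left s t r := by simp

instance : SeminormedAddCommGroup (AlgTensor H) :=
  InnerProductSpace.Core.toSeminormedAddCommGroup (c := core) (𝕜 := ℂ)

instance : InnerProductSpace ℂ (AlgTensor H) := InnerProductSpace.ofCore core

lemma inner_pure (x y : ∀ i, H i) : inner ℂ (pure x) (pure y) = ∏ i, inner ℂ (x i) (y i) :=
  form_pure_pure y x

end AlgTensor

/-- The Hilbert space tensor product `⨂ᵢ H i`: the completion of the algebraic tensor product
with respect to the inner product `⟪⨂ᵢ x i, ⨂ᵢ y i⟫ = ∏ᵢ ⟪x i, y i⟫`. -/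
abbrev HilbertTensor : Type _ := UniformSpace.Completion (AlgTensor H)

variable {H}

/-- The elementary tensor `⨂ᵢ x i`. -/
def pureTensor (x : ∀ i, H i) : HilbertTensor H := ((AlgTensor.pure x : AlgTensor H) : _)

lemma inner_pureTensor (x y : ∀ i, H i) :
    inner ℂ (pureTensor x) (pureTensor y) = ∏ i, inner ℂ (x i) (y i) := by
  rw [pureTensor, pureTensor, UniformSpace.Completion.inner_coe, AlgTensor.inner_pure]

/-! ### Identification of `(⨂ᵢ H₁ᵢ) ⊗ (⨂ⱼ H₂ⱼ)` with the full tensor product -/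

section Join

variable {κ₁ κ₂ : Type*} [Fintype κ₁] [Fintype κ₂] (e : κ₁ ⊕ κ₂ ≃ ι)

variable (H) in
/-- The bilinear map `(⨂ᵢ x i, ⨂ⱼ y j) ↦ ⨂ (x, y)` on algebraic tensor products, for a splitting
`e` of the index set into two parts. -/
def AlgTensor.join : AlgTensor (fun i => H (e (Sum.inl i))) →ₗ[ℂ]
    AlgTensor (fun j => H (e (Sum.inr j))) →ₗ[ℂ] AlgTensor H :=
  (TensorProduct.mk ℂ (⨂[ℂ] i, H (e (Sum.inl i))) (⨂[ℂ] j, H (e (Sum.inr j)))).compr₂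
    ((PiTensorProduct.reindex ℂ H e.symm).symm.toLinearMap ∘ₗ
      (PiTensorProduct.tmulEquivDep ℂ (fun j => H (e j))).toLinearMap)

lemma AlgTensor.join_pure (x : ∀ i, H i) :
    AlgTensor.join H e (AlgTensor.pure fun i => x (e (Sum.inl i)))
      (AlgTensor.pure fun j => x (e (Sum.inr j))) = AlgTensor.pure x := by
  have h : PiTensorProduct.reindex ℂ H e.symm (PiTensorProduct.tprod ℂ x)
      = PiTensorProduct.tmulEquivDep ℂ (fun j => H (e j))
        ((PiTensorProduct.tprod ℂ fun i => x (e (Sum.inl i))) ⊗ₜ[ℂ]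
          (PiTensorProduct.tprod ℂ fun j => x (e (Sum.inr j)))) := by
    rw [PiTensorProduct.reindex_tprod, PiTensorProduct.tmulEquivDep_apply]
    congr 1
    ext j
    cases j <;> rfl
  exact (LinearEquiv.symm_apply_eq _).mpr h.symm

lemma AlgTensor.inner_join (s s' : AlgTensor (fun i => H (e (Sum.inl i))))
    (t t' : AlgTensor (fun j => H (e (Sum.inr j)))) :
    inner ℂ (AlgTensor.join H e s t) (AlgTensor.join H e s' t') = inner ℂ s s' * inner ℂ t t' := by
  have glue : ∀ (x : ∀ i, H (e (Sum.inl i))) (y : ∀ j, H (e (Sum.inr j))), ∃ z : ∀ i, H i,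
      (∀ i, z (e (Sum.inl i)) = x i) ∧ ∀ j, z (e (Sum.inr j)) = y j := by
    intro x y
    let w : ∀ j, H (e j) := fun j => Sum.rec x y j
    refine ⟨(Equiv.piCongrLeft H e) w, fun i => ?_, fun j => ?_⟩
    · exact Equiv.piCongrLeft_apply_apply H e w (Sum.inl i)
    · exact Equiv.piCongrLeft_apply_apply H e w (Sum.inr j)
  induction s using AlgTensor.induction with
  | h2 a b ha hb => simp only [map_add, LinearMap.add_apply, inner_add_left, ha, hb, add_mul]
  | h1 r x =>
  induction s' using AlgTensor.induction with
  | h2 a b ha hb => simp only [map_add, LinearMap.add_apply, inner_add_right, ha, hb, add_mul]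
  | h1 r' x' =>
  induction t using AlgTensor.induction with
  | h2 a b ha hb => simp only [map_add, inner_add_left, ha, hb, mul_add]
  | h1 q y =>
  induction t' using AlgTensor.induction with
  | h2 a b ha hb => simp only [map_add, inner_add_right, ha, hb, mul_add]
  | h1 q' y' =>
  obtain ⟨z, hx, hy⟩ := glue x y
  obtain ⟨z', hx', hy'⟩ := glue x' y'
  obtain rfl : (fun i => z (e (Sum.inl i))) = x := funext hx
  obtain rfl : (fun j => z (e (Sum.inr j))) = y := funext hy
  obtain rfl : (fun i => z' (e (Sum.inl i))) = x' := funext hx'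
  obtain rfl : (fun j => z' (e (Sum.inr j))) = y' := funext hy'
  simp only [map_smul, LinearMap.smul_apply, inner_smul_left, inner_smul_right,
    AlgTensor.join_pure, AlgTensor.inner_pure]
  rw [← e.prod_comp, Fintype.prod_sum_type]
  ring

lemma AlgTensor.norm_join (s : AlgTensor (fun i => H (e (Sum.inl i))))
    (t : AlgTensor (fun j => H (e (Sum.inr j)))) : ‖AlgTensor.join H e s t‖ = ‖s‖ * ‖t‖ := by
  have h := AlgTensor.inner_join e s s t t
  rw [inner_self_eq_norm_sq_to_K, inner_self_eq_norm_sq_to_K, inner_self_eq_norm_sq_to_K] at h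
  have h' : ‖AlgTensor.join H e s t‖ ^ 2 = (‖s‖ * ‖t‖) ^ 2 := by
    rw [mul_pow]; exact_mod_cast h
  exact (pow_left_inj₀ (norm_nonneg _) (by positivity) two_ne_zero).mp h'

variable (H) in
/-- `AlgTensor.join` as a continuous bilinear map into the Hilbert space tensor product. -/
def AlgTensor.joinL : AlgTensor (fun i => H (e (Sum.inl i))) →L[ℂ]
    AlgTensor (fun j => H (e (Sum.inr j))) →L[ℂ] HilbertTensor H :=
  LinearMap.mkContinuous₂
    ((AlgTensor.join H e).compr₂ (UniformSpace.Completion.toComplL (𝕜 := ℂ)).toLinearMap) 1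
    (fun s t => by
      change ‖((AlgTensor.join H e s t : AlgTensor H) : HilbertTensor H)‖ ≤ _
      rw [UniformSpace.Completion.norm_coe, AlgTensor.norm_join, one_mul])

variable (H) in
/-- The continuous bilinear map `(u, v) ↦ u ⊗ v` that identifies the tensor product of
`⨂ᵢ H (e (inl i))` and `⨂ⱼ H (e (inr j))` with `⨂ H`: the unique continuous extension of
`AlgTensor.join` to the completions. -/
def joinTensor : HilbertTensor (fun i => H (e (Sum.inl i))) →L[ℂ]
    HilbertTensor (fun j => H (e (Sum.inr j))) →L[ℂ] HilbertTensor H :=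
  (((AlgTensor.joinL H e).extend UniformSpace.Completion.toComplL).flip.extend
    UniformSpace.Completion.toComplL).flip

lemma joinTensor_coe (s : AlgTensor (fun i => H (e (Sum.inl i))))
    (t : AlgTensor (fun j => H (e (Sum.inr j)))) :
    joinTensor H e s t = ((AlgTensor.join H e s t : AlgTensor H) : HilbertTensor H) := by
  have h1 : (AlgTensor.joinL H e).extend UniformSpace.Completion.toComplL s
      = AlgTensor.joinL H e s :=
    ContinuousLinearMap.extend_eq _ UniformSpace.Completion.denseRange_coe
      (UniformSpace.Completion.isUniformInducing_coe _) s
  have h2 : ((AlgTensor.joinL H e).extend UniformSpace.Completion.toComplL).flip.extend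
      UniformSpace.Completion.toComplL t
      = ((AlgTensor.joinL H e).extend UniformSpace.Completion.toComplL).flip t :=
    ContinuousLinearMap.extend_eq _ UniformSpace.Completion.denseRange_coe
      (UniformSpace.Completion.isUniformInducing_coe _) t
  rw [joinTensor, ContinuousLinearMap.flip_apply, h2, ContinuousLinearMap.flip_apply, h1]
  rfl

lemma joinTensor_pureTensor (x : ∀ i, H i) :
    joinTensor H e (pureTensor fun i => x (e (Sum.inl i)))
      (pureTensor fun j => x (e (Sum.inr j))) = pureTensor x := by
  rw [pureTensor, pureTensor, joinTensor_coe, AlgTensor.join_pure, pureTensor]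

end Join

end HilbertTensorProduct

/-! ## Matrix product states -/

section MPS

/-- Possibly infinite complex matrices. Matrices of smaller (or one-row, one-column) shape are
extended by zero. -/
abbrev BondMatrix : Type := ℕ → ℕ → ℂ

/-- `IsMatrixProduct [M₁, …, Mₘ] P`: the product of the matrices `M₁, …, Mₘ` exists and equals `P`,
i.e. `P a b = ∑ a₁, ⋯ ∑ aₘ₋₁, M₁ a a₁ * M₂ a₁ a₂ * ⋯ * Mₘ aₘ₋₁ b` for all `a`, `b`, where all of the
(iterated, innermost sum over `aₘ₋₁`) series converge in `ℂ`. -/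
def IsMatrixProduct : List BondMatrix → BondMatrix → Prop
  | [], P => P = fun a b => if a = b then 1 else 0
  | [M], P => P = M
  | M :: M' :: L, P => ∃ Q, IsMatrixProduct (M' :: L) Q ∧
      ∀ a b, HasSum (fun c => M a c * Q c b) (P a b)

/-- The factors `M₁ Λ₁, M₂ Λ₂, …, Mₘ₋₁ Λₘ₋₁, Mₘ`, where `Λᵢ` is the diagonal matrix with
diagonal `Λ i`; there is no diagonal matrix to the right of the last factor `Mₘ`. -/
def mpsFactors {m : ℕ} (M : Fin m → BondMatrix) (Λ : Fin m → ℕ → ℝ) : List BondMatrix :=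
  List.ofFn fun i a b => M i a b * (if (i : ℕ) + 1 < m then (Λ i b : ℂ) else 1)

variable {m : ℕ} {H : Fin m → Type*}
  [∀ i, NormedAddCommGroup (H i)] [∀ i, InnerProductSpace ℂ (H i)] {K : Fin m → Type*}

/-- The product basis vector `|k₁, …, kₘ⟩ = |k₁⟩ ⊗ ⋯ ⊗ |kₘ⟩`. -/
def ket (b : ∀ i, HilbertBasis (K i) ℂ (H i)) (k : ∀ i, K i) : HilbertTensor H :=
  pureTensor fun i => b i (k i)

/-- `φ = ∑_{k₁,…,kₘ} (M₁^{(k₁)} Λ₁ M₂^{(k₂)} Λ₂ ⋯ Λₘ₋₁ Mₘ^{(kₘ)})_{a, a'} |k₁, …, kₘ⟩`, where the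
matrix products converge entrywise in `ℂ` and the sum over `k₁, …, kₘ` converges in norm. -/
def IsMatrixProductVector (b : ∀ i, HilbertBasis (K i) ℂ (H i))
    (M : ∀ i, K i → BondMatrix) (Λ : Fin m → ℕ → ℝ) (a a' : ℕ) (φ : HilbertTensor H) : Prop :=
  ∃ c : (∀ i, K i) → ℂ,
    (∀ k, ∃ P, IsMatrixProduct (mpsFactors (fun i => M i (k i)) Λ) P ∧ P a a' = c k) ∧
    HasSum (fun k => c k • ket b k) φ

end MPS

section CanonicalForms

variable {N : ℕ} {H : Fin N → Type*}
  [∀ i, NormedAddCommGroup (H i)] [∀ i, InnerProductSpace ℂ (H i)] {K : Fin N → Type*}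

/-- Matrix product states with open boundary conditions on `N` sites `0, …, N - 1`. The bonds are
numbered `0, …, N`; site `i` lies between the bonds `i` and `i + 1`, and the bond index on bond `j`
runs through `{a : ℕ | a < D j}`, where the bond dimension `D j` is in `ℕ ∪ {∞}`. The two outer
bonds have dimension one (their index is the dummy index `0`). `M i k` is the matrix of site `i` for
the physical index `k`; it has `D i` rows and `D (i + 1)` columns. `Λ j` is the diagonal of the
diagonal matrix on bond `j`, for `0 < j < N`. -/
structure IsMPS (b : ∀ i, HilbertBasis (K i) ℂ (H i)) (D : ℕ → ℕ∞)
    (M : ∀ i, K i → BondMatrix) (Λ : ℕ → ℕ → ℝ) (ψ : HilbertTensor H) : Prop where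
  left_dim : D 0 = 1
  right_dim : D N = 1
  support : ∀ (i : Fin N) (k : K i) (a a' : ℕ),
    M i k a a' ≠ 0 → (a : ℕ∞) < D i ∧ (a' : ℕ∞) < D ((i : ℕ) + 1)
  expansion : IsMatrixProductVector b M (fun i => Λ ((i : ℕ) + 1)) 0 0 ψ

/-- The matrices of site `i` are left-normalized:
`∑_k ∑_a conj (M^{(k)}_{a, c}) * M^{(k)}_{a, c'} = δ_{c c'}`. -/
def LeftNormalized (D : ℕ → ℕ∞) (M : ∀ i, K i → BondMatrix) (i : Fin N) : Prop :=
  ∀ c c' : ℕ, (c : ℕ∞) < D ((i : ℕ) + 1) → (c' : ℕ∞) < D ((i : ℕ) + 1) →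
    HasSum (fun p : K i × ℕ => conj (M i p.1 p.2 c) * M i p.1 p.2 c') (if c = c' then 1 else 0)

/-- The matrices of site `i` are right-normalized:
`∑_k ∑_a M^{(k)}_{c, a} * conj (M^{(k)}_{c', a}) = δ_{c c'}`. -/
def RightNormalized (D : ℕ → ℕ∞) (M : ∀ i, K i → BondMatrix) (i : Fin N) : Prop :=
  ∀ c c' : ℕ, (c : ℕ∞) < D i → (c' : ℕ∞) < D i →
    HasSum (fun p : K i × ℕ => M i p.1 c p.2 * conj (M i p.1 c' p.2)) (if c = c' then 1 else 0)

/-- Left-canonical matrix product states: there are no diagonal matrices, and all of the matrices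
are left-normalized. -/
def IsLeftCanonical (b : ∀ i, HilbertBasis (K i) ℂ (H i)) (D : ℕ → ℕ∞)
    (A : ∀ i, K i → BondMatrix) (ψ : HilbertTensor H) : Prop :=
  IsMPS b D A 1 ψ ∧ ∀ i, LeftNormalized D A i

/-- Right-canonical matrix product states: there are no diagonal matrices, and all of the matrices
are right-normalized. -/
def IsRightCanonical (b : ∀ i, HilbertBasis (K i) ℂ (H i)) (D : ℕ → ℕ∞)
    (B : ∀ i, K i → BondMatrix) (ψ : HilbertTensor H) : Prop :=
  IsMPS b D B 1 ψ ∧ ∀ i, RightNormalized D B i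

/-- Mixed-canonical matrix product states with respect to the cut `(1, …, n) : (n + 1, …, N)`: the
only diagonal matrix is on bond `n` and has nonnegative entries `d`, the matrices to the left of it
are left-normalized, and those to the right of it are right-normalized. -/
def IsMixedCanonical (b : ∀ i, HilbertBasis (K i) ℂ (H i)) (n : ℕ) (D : ℕ → ℕ∞)
    (M : ∀ i, K i → BondMatrix) (d : ℕ → ℝ) (ψ : HilbertTensor H) : Prop :=
  IsMPS b D M (fun j => if j = n then d else 1) ψ ∧ (∀ a, 0 ≤ d a) ∧
    (∀ i : Fin N, (i : ℕ) < n → LeftNormalized D M i) ∧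
    (∀ i : Fin N, n ≤ (i : ℕ) → RightNormalized D M i)

/-- The splitting of the `N` sites into the first `n` and the last `N - n` ones. -/
def cutEquiv {N : ℕ} (n : ℕ) (hn : n ≤ N) : Fin n ⊕ Fin (N - n) ≃ Fin N :=
  finSumFinEquiv.trans (finCongr (Nat.add_sub_cancel' hn))

/-- The site `i` of the left part of the cut, as one of the `N` sites. -/
abbrev leftSite (n : ℕ) (hn : n ≤ N) (i : Fin n) : Fin N := cutEquiv n hn (Sum.inl i)

/-- The site `j` of the right part of the cut, as one of the `N` sites. -/
abbrev rightSite (n : ℕ) (hn : n ≤ N) (j : Fin (N - n)) : Fin N := cutEquiv n hn (Sum.inr j)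

/-- `∑_{a < r} lam a • (φ a ⊗ χ a)` is a Schmidt decomposition of `ψ` with respect to the cut
`(1, …, n) : (n + 1, …, N)`. -/
structure IsSchmidtDecomposition (n : ℕ) (hn : n ≤ N) (r : ℕ∞) (lam : ℕ → ℝ)
    (φ : ℕ → HilbertTensor fun i => H (leftSite n hn i))
    (χ : ℕ → HilbertTensor fun j => H (rightSite n hn j)) (ψ : HilbertTensor H) : Prop where
  orthonormal_left : Orthonormal ℂ fun a : {a : ℕ // (a : ℕ∞) < r} => φ a
  orthonormal_right : Orthonormal ℂ fun a : {a : ℕ // (a : ℕ∞) < r} => χ a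
  nonneg : ∀ a : ℕ, (a : ℕ∞) < r → 0 ≤ lam a
  tendsto_zero : Tendsto (fun a : {a : ℕ // (a : ℕ∞) < r} => lam a) cofinite (𝓝 0)
  hasSum : HasSum (fun a : {a : ℕ // (a : ℕ∞) < r} =>
    (lam a : ℂ) • joinTensor H (cutEquiv n hn) (φ a) (χ a)) ψ

/-- Canonical (`Γ`-`Λ`) matrix product states: for every `0 < n < N`, cutting the matrix product at
bond `n` gives a Schmidt decomposition of `ψ` with coefficients `Λ n`. -/
def IsCanonical (b : ∀ i, HilbertBasis (K i) ℂ (H i)) (D : ℕ → ℕ∞)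
    (Γ : ∀ i, K i → BondMatrix) (Λ : ℕ → ℕ → ℝ) (ψ : HilbertTensor H) : Prop :=
  IsMPS b D Γ Λ ψ ∧
  ∀ (n : ℕ) (_ : 0 < n) (hn : n < N),
    ∃ (φ : ℕ → HilbertTensor fun i => H (leftSite n hn.le i))
      (χ : ℕ → HilbertTensor fun j => H (rightSite n hn.le j)),
      (∀ a : ℕ, (a : ℕ∞) < D n →
        IsMatrixProductVector (fun i => b (leftSite n hn.le i))
          (fun i => Γ (leftSite n hn.le i)) (fun i => Λ ((leftSite n hn.le i : ℕ) + 1)) 0 a (φ a)) ∧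
      (∀ a : ℕ, (a : ℕ∞) < D n →
        IsMatrixProductVector (fun j => b (rightSite n hn.le j))
          (fun j => Γ (rightSite n hn.le j)) (fun j => Λ ((rightSite n hn.le j : ℕ) + 1)) a 0 (χ a)) ∧
      IsSchmidtDecomposition n hn.le (D n) (Λ n) φ χ ψ

end CanonicalForms

end

/-! After expansion in the product basis, `ψ` is a square summable function on words (lists of pairs
of a site and a basis index), supported on the words that list the sites in order. The wave
functions of all segments of sites live in this single space of functions on words, and `sliceR w x
= x (· ++ w)`, `sliceL w x = x (w ++ ·)` are the partial contractions with basis vectors.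

Suppose orthonormal families `φ j` of wave functions of the first `j` sites are nested: every
one-letter slice of `φ (j + 1)` lies in the closed span of `φ j`. Put `A a c = ⟪φ j a, sliceR [s] (φ
(j + 1) c)⟫`. Parseval at bond `j + 1` gives `∑ c, A a c * ⟪φ (j + 1) c, y⟫ = ⟪φ j a, sliceR [s]
y⟫`, so products of such matrices collapse, with all bond sums convergent, to `⟪φ 0 a, sliceR w (φ N
b)⟫`. For `φ 0 = δ_[]` and `φ N = ψ` the entry at `0, 0` is the coefficient `ψ w`. Parseval over all
letters of a site is left normalization. Right chains are the mirror image. See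
`IsPartialOrthonormal.hasSum_mul_slice`, `IsLeftChain.isMatrixProduct`,
`IsRightChain.isMatrixProduct` and `IsPartialOrthonormal.hasSum_prod`.

The four forms differ in the choice of families. For the left and right forms, bases of the full
segment spaces serve at all inner bonds, and nesting is automatic. The mixed form glues a left chain
ending in the left Schmidt vectors at the cut to a right chain starting with the right ones; adding
further orthonormal vectors with weight zero makes the bond infinite. The Vidal form uses Schmidt
vectors at every cut. They are nested since slices of columns of the cut matrix are columns at the
neighbouring cut. With `Γ = σ⁻¹ * (left matrix)`, left products telescope to `φ n`, while
`IsCut.mul_inner_slice` turns `Γ Λ` into the right matrix, so right products give `χ n`. Inverse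
weights occur only entrywise and cause no convergence problem.

The Schmidt decomposition (`exists_schmidt`) comes from the spectral theorem for the compact
positive operator `∑ᵢ |xᵢ⟩⟨xᵢ|` built from the columns. -/

noncomputable section

/-! ## Orthonormal sequences of possibly finite length -/

section PartialOrthonormal

variable {E : Type*} [NormedAddCommGroup E] [InnerProductSpace ℂ E]

/-- The first `D ∈ ℕ ∪ {∞}` vectors of the sequence `φ` are orthonormal, the others vanish. -/
def IsPartialOrthonormal (D : ℕ∞) (φ : ℕ → E) : Prop :=
  ∀ a b : ℕ, inner ℂ (φ a) (φ b) = if a = b ∧ (a : ℕ∞) < D then 1 else 0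

/-- The family is a Hilbert basis of its own closed span, so this is the basis expansion there,
pushed forward by the inclusion. -/
lemma Orthonormal.hasSum_inner_smul_of_mem_closure [CompleteSpace E] {ι : Type*} {v : ι → E}
    (hv : Orthonormal ℂ v) {y : E}
    (hy : y ∈ (Submodule.span ℂ (Set.range v)).topologicalClosure) :
    HasSum (fun i => inner ℂ (v i) y • v i) y := by
  set U := (Submodule.span ℂ (Set.range v)).topologicalClosure with hU
  have hmem : ∀ i, v i ∈ U := fun i =>
    Submodule.le_topologicalClosure _ (Submodule.subset_span ⟨i, rfl⟩)
  let w : ι → U := fun i => ⟨v i, hmem i⟩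
  have hw : Orthonormal ℂ w := by
    rw [← LinearIsometry.orthonormal_comp_iff U.subtypeₗᵢ]
    exact hv
  have : CompleteSpace U :=
    (Submodule.isClosed_topologicalClosure _).completeSpace_coe
  let B : HilbertBasis ι ℂ U := HilbertBasis.mkOfOrthogonalEqBot hw (by
    rw [Submodule.eq_bot_iff]
    rintro ⟨z, hz⟩ hzo
    have h1 : ∀ i, inner ℂ (v i) z = 0 := fun i =>
      (Submodule.mem_orthogonal _ _).mp hzo (w i) (Submodule.subset_span ⟨i, rfl⟩)
    have h2 : z ∈ Uᗮ := by
      rw [hU, Submodule.orthogonal_closure, Submodule.mem_orthogonal]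
      intro u hu
      induction hu using Submodule.span_induction with
      | mem x hx => obtain ⟨i, rfl⟩ := hx; exact h1 i
      | zero => simp
      | add x y _ _ h1 h2 => rw [inner_add_left, h1, h2, add_zero]
      | smul c x _ h => rw [inner_smul_left, h, mul_zero]
    have : z = 0 := inner_self_eq_zero.mp ((Submodule.mem_orthogonal _ _).mp h2 z hz)
    exact Subtype.ext this)
  have hB : ∀ i, B i = w i := fun i => by simp [B]
  have h := (B.hasSum_repr ⟨y, hy⟩).mapL U.subtypeL
  simpa [B.repr_apply_apply, hB, w] using h

namespace IsPartialOrthonormal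

variable {D : ℕ∞} {φ : ℕ → E}

lemma eq_zero (h : IsPartialOrthonormal D φ) {a : ℕ} (ha : ¬ (a : ℕ∞) < D) : φ a = 0 := by
  have := h a a
  rw [if_neg (fun h => ha h.2)] at this
  exact inner_self_eq_zero.mp this

lemma orthonormal (h : IsPartialOrthonormal D φ) :
    Orthonormal ℂ fun a : {a : ℕ // (a : ℕ∞) < D} => φ a := by
  classical
  rw [orthonormal_iff_ite]
  rintro ⟨a, ha⟩ ⟨b, hb⟩
  rw [h a b]
  simp [ha, Subtype.ext_iff]

lemma span_range (h : IsPartialOrthonormal D φ) :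
    Submodule.span ℂ (Set.range fun a : {a : ℕ // (a : ℕ∞) < D} => φ a)
      = Submodule.span ℂ (Set.range φ) := by
  refine le_antisymm (Submodule.span_mono ?_) (Submodule.span_le.mpr ?_)
  · rintro _ ⟨a, rfl⟩
    exact ⟨a, rfl⟩
  · rintro _ ⟨a, rfl⟩
    by_cases ha : (a : ℕ∞) < D
    · exact Submodule.subset_span ⟨⟨a, ha⟩, rfl⟩
    · rw [h.eq_zero ha]
      exact Submodule.zero_mem _

/-- The padding by zero vectors adds only zero terms, so bond sums can run over all of `ℕ` whatever
the bond dimension. -/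
lemma hasSum_inner_smul [CompleteSpace E] (h : IsPartialOrthonormal D φ) {y : E}
    (hy : y ∈ (Submodule.span ℂ (Set.range φ)).topologicalClosure) :
    HasSum (fun a => inner ℂ (φ a) y • φ a) y := by
  rw [← h.span_range] at hy
  have := h.orthonormal.hasSum_inner_smul_of_mem_closure hy
  refine (hasSum_subtype_iff_of_support_subset (f := fun a => inner ℂ (φ a) y • φ a)
    (s := {a : ℕ | (a : ℕ∞) < D}) ?_).mp this
  intro a ha
  by_contra hD
  exact ha (by simp [h.eq_zero hD])

/-- Parseval's identity. -/
lemma hasSum_inner_mul_inner [CompleteSpace E] (h : IsPartialOrthonormal D φ) (x : E) {y : E}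
    (hy : y ∈ (Submodule.span ℂ (Set.range φ)).topologicalClosure) :
    HasSum (fun a => inner ℂ x (φ a) * inner ℂ (φ a) y) (inner ℂ x y) := by
  have := (h.hasSum_inner_smul hy).mapL (innerSL ℂ x)
  simpa [inner_smul_right, mul_comm] using this

lemma inner_self (h : IsPartialOrthonormal D φ) {a b : ℕ} (ha : (a : ℕ∞) < D) :
    inner ℂ (φ a) (φ b) = if a = b then 1 else 0 := by
  simp [h a b, ha]

end IsPartialOrthonormal

lemma exists_equiv_lt_enat (ι : Type*) [Countable ι] :
    ∃ D : ℕ∞, Nonempty ({a : ℕ // (a : ℕ∞) < D} ≃ ι) ∧ (Infinite ι → D = ⊤) := by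
  cases finite_or_infinite ι with
  | inl h =>
    refine ⟨Nat.card ι, ⟨?_⟩, fun h' => (h'.not_finite h).elim⟩
    refine (Equiv.subtypeEquivRight fun a => by simp).trans
      ((Fin.equivSubtype.symm).trans (Finite.equivFin ι).symm)
  | inr h =>
    obtain ⟨e⟩ := nonempty_equiv_of_countable (α := ℕ) (β := ι)
    exact ⟨⊤, ⟨(Equiv.subtypeUnivEquiv fun a => by simp).trans e⟩, fun _ => rfl⟩

/-- A countable orthonormal family, enumerated by an initial segment of `ℕ`. -/
lemma Orthonormal.exists_isPartialOrthonormal {ι : Type*} [Countable ι] {v : ι → E}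
    (hv : Orthonormal ℂ v) :
    ∃ (D : ℕ∞) (e : {a : ℕ // (a : ℕ∞) < D} ≃ ι) (φ : ℕ → E), IsPartialOrthonormal D φ ∧
      (∀ a : {a : ℕ // (a : ℕ∞) < D}, φ a = v (e a)) ∧ (Infinite ι → D = ⊤) := by
  classical
  obtain ⟨D, ⟨e⟩, hD⟩ := exists_equiv_lt_enat ι
  refine ⟨D, e, fun a => if h : (a : ℕ∞) < D then v (e ⟨a, h⟩) else 0, ?_, ?_, hD⟩
  · intro a b
    by_cases ha : (a : ℕ∞) < D
    · by_cases hb : (b : ℕ∞) < D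
      · simp only [ha, hb, dif_pos, and_true]
        rw [orthonormal_iff_ite.mp hv]
        simp
      · have : a ≠ b := by rintro rfl; exact hb ha
        simp [hb, this]
    · simp [ha]
  · rintro ⟨a, ha⟩
    simp [ha]

/-- By Bessel each `x j` has nonzero coefficients on only countably many `v i`, and totality forces
every `v i` to meet some `x j`. -/
lemma Orthonormal.countable_of_total {ι J : Type*} [Countable J] {v : ι → E}
    (hv : Orthonormal ℂ v) (x : J → E) (hx : ∀ y, (∀ j, inner ℂ y (x j) = 0) → y = 0) :
    Countable ι := by
  have h : ∀ j, (Function.support fun i => ‖inner ℂ (v i) (x j)‖ ^ 2).Countable := fun j =>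
    (hv.inner_products_summable (x := x j)).countable_support
  rw [← Set.countable_univ_iff]
  refine (Set.countable_iUnion h).mono fun i _ => ?_
  by_contra hi
  refine hv.ne_zero i (hx _ fun j => ?_)
  by_contra hj
  exact hi (Set.mem_iUnion.mpr ⟨j, by simpa using hj⟩)

lemma HilbertBasis.countable_of_separable [TopologicalSpace.SeparableSpace E] {ι : Type*}
    (b : HilbertBasis ι ℂ E) : Countable ι := by
  refine b.orthonormal.countable_of_total (TopologicalSpace.denseSeq E) fun y hy => ?_
  have h : (fun z => inner ℂ y z) = fun _ => (0 : ℂ) :=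
    Continuous.ext_on (TopologicalSpace.denseRange_denseSeq E) (by fun_prop) (by fun_prop) (by
      rintro _ ⟨j, rfl⟩
      exact hy j)
  exact inner_self_eq_zero.mp (congrFun h y)

/-- An orthonormal basis of a closed subspace, enumerated by an initial segment of `ℕ`. -/
lemma Submodule.exists_isPartialOrthonormal [CompleteSpace E] {J : Type*} [Countable J]
    (x : J → E) (hx : ∀ y, (∀ j, inner ℂ y (x j) = 0) → y = 0)
    (U : Submodule ℂ E) (hU : IsClosed (U : Set E)) :
    ∃ (D : ℕ∞) (φ : ℕ → E), IsPartialOrthonormal D φ ∧ (∀ a, φ a ∈ U) ∧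
      U ≤ (Submodule.span ℂ (Set.range φ)).topologicalClosure ∧
      (¬ FiniteDimensional ℂ U → D = ⊤) := by
  have : CompleteSpace U := hU.completeSpace_coe
  obtain ⟨w, B, hB⟩ := exists_hilbertBasis ℂ U
  have hv : Orthonormal ℂ fun i : w => ((i : U) : E) := by
    have := B.orthonormal.comp_linearIsometry U.subtypeₗᵢ
    rw [hB] at this
    exact this
  have := hv.countable_of_total x hx
  obtain ⟨D, e, φ, hφ, hφe, hD⟩ := hv.exists_isPartialOrthonormal
  have hmem : ∀ a, φ a ∈ U := by
    intro a
    by_cases ha : (a : ℕ∞) < D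
    · rw [hφe ⟨a, ha⟩]
      exact Subtype.mem _
    · rw [hφ.eq_zero ha]
      exact U.zero_mem
  refine ⟨D, φ, hφ, hmem, ?_, fun hinf => hD ?_⟩
  · intro y hy
    have h1 := (B.hasSum_repr ⟨y, hy⟩).mapL U.subtypeL
    refine Submodule.isClosed_topologicalClosure _ |>.mem_of_tendsto h1
      (Filter.Eventually.of_forall fun s => ?_)
    refine Submodule.le_topologicalClosure _ (Submodule.sum_mem _ fun i _ => ?_)
    simp only [map_smul]
    refine Submodule.smul_mem _ _ (Submodule.subset_span ⟨e.symm i, ?_⟩)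
    rw [hφe, e.apply_symm_apply, hB]
    rfl
  · by_contra hfin
    rw [not_infinite_iff_finite] at hfin
    have := Fintype.ofFinite w
    exact hinf (B.toOrthonormalBasis.toBasis.finiteDimensional_of_finite)

/-- Extension to an infinite orthonormal sequence inside an infinite-dimensional subspace. -/
lemma IsPartialOrthonormal.exists_extension [CompleteSpace E] {D : ℕ∞} {φ : ℕ → E}
    (hφ : IsPartialOrthonormal D φ) (U : Submodule ℂ E) (hU : IsClosed (U : Set E))
    (hφU : ∀ a, φ a ∈ U) (hinf : ¬ FiniteDimensional ℂ U) :
    ∃ φ' : ℕ → E, IsPartialOrthonormal ⊤ φ' ∧ (∀ a, φ' a ∈ U) ∧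
      ∀ a : ℕ, (a : ℕ∞) < D → φ' a = φ a := by
  classical
  induction D using ENat.recTopCoe with
  | top => exact ⟨φ, hφ, hφU, fun _ _ => rfl⟩
  | coe d =>
  have : CompleteSpace U := hU.completeSpace_coe
  let v : {a : ℕ // (a : ℕ∞) < d} → U := fun a => ⟨φ a, hφU a⟩
  have hv : Orthonormal ℂ v := by
    rw [← LinearIsometry.orthonormal_comp_iff U.subtypeₗᵢ]
    exact hφ.orthonormal
  -- The finite family extends to a Hilbert basis `w` of `U`, which is infinite because `U` is
  -- infinite-dimensional. A sequence of new basis vectors, enumerated by `g`, is appended from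
  -- position `d` on.
  obtain ⟨w, B, hsw, hB⟩ := hv.toSubtypeRange.exists_hilbertBasis_extension
  have hBo : Orthonormal ℂ ((↑) : w → U) := hB ▸ B.orthonormal
  have hfin : (Set.range v).Finite := by
    have : Finite {a : ℕ // (a : ℕ∞) < d} := by
      have : Finite {a : ℕ // a < d} := inferInstance
      simpa using this
    exact Set.finite_range v
  have hwinf : w.Infinite := by
    intro hw
    have := hw.fintype
    exact hinf (B.toOrthonormalBasis.toBasis.finiteDimensional_of_finite)
  have hdiff : (w \ Set.range v).Infinite := hwinf.sdiff hfin
  let g := hdiff.natEmbedding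
  have hg1 : ∀ a, (g a : U) ∈ w := fun a => (g a).2.1
  have hg2 : ∀ a, (g a : U) ∉ Set.range v := fun a => (g a).2.2
  have hin : ∀ x y : U, x ∈ w → y ∈ w → inner ℂ (x : E) (y : E) = if x = y then (1 : ℂ) else 0 := by
    intro x y hx hy
    have := orthonormal_iff_ite.mp hBo ⟨x, hx⟩ ⟨y, hy⟩
    simpa using this
  let f : ℕ → U := fun a => if h : (a : ℕ∞) < d then v ⟨a, h⟩ else g (a - d)
  have hf1 : ∀ a, f a ∈ w := by
    intro a
    by_cases h : (a : ℕ∞) < d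
    · simp only [f, dif_pos h]; exact hsw ⟨_, rfl⟩
    · simp only [f, dif_neg h]; exact hg1 _
  have hf2 : Function.Injective f := by
    intro a b hab
    by_cases ha : (a : ℕ∞) < d <;> by_cases hb : (b : ℕ∞) < d
    · simp only [f, dif_pos ha, dif_pos hb] at hab
      simpa using hv.linearIndependent.injective hab
    · simp only [f, dif_pos ha, dif_neg hb] at hab
      exact (hg2 _ ⟨_, hab⟩).elim
    · simp only [f, dif_neg ha, dif_pos hb] at hab
      exact (hg2 _ ⟨_, hab.symm⟩).elim
    · simp only [f, dif_neg ha, dif_neg hb] at hab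
      have := g.injective (Subtype.ext hab)
      simp only [Nat.cast_lt, not_lt] at ha hb
      omega
  refine ⟨fun a => f a, fun a b => ?_, fun a => (f a).2, fun a ha => ?_⟩
  · rw [hin _ _ (hf1 a) (hf1 b)]
    simp [hf2.eq_iff]
  · simp only [f, dif_pos ha, v]

end PartialOrthonormal

/-! ## Diagonalization of the trace class operator `∑ᵢ |xᵢ⟩⟨xᵢ|` -/

section Spectral

variable {E : Type*} [NormedAddCommGroup E] [InnerProductSpace ℂ E]

lemma isCompactOperator_rankOne (x y : E) :
    IsCompactOperator (InnerProductSpace.rankOne ℂ x y) := by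
  rw [InnerProductSpace.rankOne_def']
  exact (isCompactOperator_of_locallyCompactSpace_dom (innerSL ℂ y)).clm_comp
    (ContinuousLinearMap.toSpanSingleton ℂ x)

variable [CompleteSpace E]

/-- Since `|x⟩⟨x|` has norm `‖x‖ ^ 2`, the series converges in operator norm. Finite rank partial
sums make the limit compact, and symmetry is checked termwise. -/
lemma exists_compact_symmetric_of_summable {I : Type*} (x : I → E)
    (hx : Summable fun i => ‖x i‖ ^ 2) :
    ∃ T : E →L[ℂ] E, IsCompactOperator T ∧ T.IsSymmetric ∧
      ∀ y, HasSum (fun i => inner ℂ (x i) y • x i) (T y) := by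
  have hs : Summable fun i => InnerProductSpace.rankOne ℂ (x i) (x i) := by
    refine Summable.of_norm ?_
    simpa [sq] using hx
  obtain ⟨T, hT⟩ := hs
  have hTy : ∀ y, HasSum (fun i => inner ℂ (x i) y • x i) (T y) := fun y => by
    simpa using hT.mapL (ContinuousLinearMap.apply ℂ E y)
  refine ⟨T, ?_, ?_, hTy⟩
  · refine isCompactOperator_of_tendsto hT (Filter.Eventually.of_forall fun s => ?_)
    exact Submodule.sum_mem (compactOperator (RingHom.id ℂ) E E)
      fun i _ => isCompactOperator_rankOne (x i) (x i)
  · intro y z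
    have h1 := (hTy z).mapL (innerSL ℂ y)
    have h2 := (hTy y).mapL (innerSL ℂ z)
    have h3 := h2.star
    simp only [innerSL_apply_apply, inner_smul_right, RCLike.star_def, map_mul,
      inner_conj_symm] at h1 h3
    refine h3.unique ?_
    simp only [mul_comm] at h1 ⊢
    exact h1

/-- The nonzero spectral data of `∑ᵢ |xᵢ⟩⟨xᵢ|`, with eigenvalues `σ a ^ 2`. -/
lemma exists_singular_vectors {I : Type*} (x : I → E) (hx : Summable fun i => ‖x i‖ ^ 2) :
    ∃ (D : ℕ∞) (φ : ℕ → E) (σ : ℕ → ℝ), IsPartialOrthonormal D φ ∧ (∀ a, 0 < σ a) ∧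
      (∀ a, HasSum (fun i => inner ℂ (x i) (φ a) • x i) ((σ a : ℂ) ^ 2 • φ a)) ∧
      Summable (fun a : {a : ℕ // (a : ℕ∞) < D} => σ a ^ 2) ∧
      ∀ i, x i ∈ (Submodule.span ℂ (Set.range φ)).topologicalClosure := by
  classical
  obtain ⟨T, hTc, hTs, hT⟩ := exists_compact_symmetric_of_summable x hx
  have hTc' : ∀ μ : ℂ, IsClosed (Module.End.eigenspace (T : Module.End ℂ E) μ : Set E) := by
    intro μ
    have : (Module.End.eigenspace (T : Module.End ℂ E) μ : Set E) = {y | T y = μ • y} := by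
      ext y; simp
    rw [this]
    exact isClosed_eq (by fun_prop) (by fun_prop)
  have hbasis : ∀ μ : ℂ, ∃ (w : Set (Module.End.eigenspace (T : Module.End ℂ E) μ))
      (B : HilbertBasis w ℂ (Module.End.eigenspace (T : Module.End ℂ E) μ)),
      ⇑B = ((↑) : w → Module.End.eigenspace (T : Module.End ℂ E) μ) := by
    intro μ
    have := (hTc' μ).completeSpace_coe
    exact exists_hilbertBasis ℂ _
  choose w B hB using hbasis
  -- The quadratic form of `T` is a sum of squares: nonzero eigenvalues are therefore positive, and
  -- the kernel of `T` is orthogonal to every `x i`.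
  have hinner : ∀ y, HasSum (fun i => ((‖inner ℂ (x i) y‖ ^ 2 : ℝ) : ℂ)) (inner ℂ y (T y)) := by
    intro y
    have h := (hT y).mapL (innerSL ℂ y)
    simp only [innerSL_apply_apply, inner_smul_right] at h
    have hi : ∀ i, ((‖inner ℂ (x i) y‖ ^ 2 : ℝ) : ℂ) = inner ℂ (x i) y * inner ℂ y (x i) := by
      intro i
      rw [← inner_conj_symm y (x i), Complex.mul_conj, Complex.normSq_eq_norm_sq]
    simp only [hi]
    exact h
  -- Bases of the eigenspaces of nonzero eigenvalues only; the kernel of `T` may be too large to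
  -- enumerate and is not needed.
  let v : (Σ μ : {μ : ℂ // μ ≠ 0}, w μ) → E := fun p =>
    ((p.2 : Module.End.eigenspace (T : Module.End ℂ E) p.1) : E)
  have hTv : ∀ p, T (v p) = (p.1 : ℂ) • v p := fun p =>
    Module.End.mem_eigenspace_iff.mp (p.2 : Module.End.eigenspace (T : Module.End ℂ E) p.1).2
  have hv : Orthonormal ℂ v := by
    rw [orthonormal_iff_ite]
    rintro ⟨μ, i⟩ ⟨ν, j⟩
    by_cases h : μ = ν
    · subst h
      have h1 : Orthonormal ℂ (fun i : w μ => (i : Module.End.eigenspace (T : Module.End ℂ E) μ)) :=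
        hB μ ▸ (B μ).orthonormal
      have h2 := orthonormal_iff_ite.mp h1 i j
      simpa using h2
    · have h1 : (μ : ℂ) ≠ ν := fun h' => h (Subtype.ext h')
      rw [if_neg (by intro h'; exact h (congrArg Sigma.fst h'))]
      exact hTs.orthogonalFamily_eigenspaces h1 _ _
  have hnorm : ∀ p, HasSum (fun i => ‖inner ℂ (x i) (v p)‖ ^ 2) (p.1 : ℂ).re ∧
      (p.1 : ℂ) = ((p.1 : ℂ).re : ℂ) := by
    intro p
    have h1 := hinner (v p)
    rw [hTv, inner_smul_right, inner_self_eq_norm_sq_to_K, hv.1 p] at h1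
    simp only [Complex.coe_algebraMap, Complex.ofReal_one, one_pow, mul_one] at h1
    have h2 := Complex.hasSum_re h1
    simp only [Complex.ofReal_re] at h2
    exact ⟨h2, h1.unique (Complex.hasSum_ofReal.mpr h2)⟩
  have hpos : ∀ p : Σ μ : {μ : ℂ // μ ≠ 0}, w μ, 0 < (p.1 : ℂ).re := by
    intro p
    refine lt_of_le_of_ne ((hnorm p).1.nonneg fun i => by positivity) fun h => ?_
    have := (hnorm p).2
    rw [← h] at this
    exact p.1.2 (by simpa using this)
  -- The trace bound: exchanging the sums and applying Bessel to each `x i` bounds every finite sum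
  -- of eigenvalues by `∑ ‖x i‖ ^ 2`. Countability of the index set follows from positivity of the
  -- eigenvalues.
  have hsum : Summable fun p : Σ μ : {μ : ℂ // μ ≠ 0}, w μ => (p.1 : ℂ).re := by
    refine summable_of_sum_le (fun p => (hpos p).le) (c := ∑' i, ‖x i‖ ^ 2) fun s => ?_
    have h1 : HasSum (fun i => ∑ p ∈ s, ‖inner ℂ (x i) (v p)‖ ^ 2) (∑ p ∈ s, (p.1 : ℂ).re) :=
      hasSum_sum fun p _ => (hnorm p).1
    refine hasSum_le (fun i => ?_) h1 hx.hasSum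
    have := hv.sum_inner_products_le (x i) (s := s)
    simpa only [norm_inner_symm] using this
  have hcount : Countable (Σ μ : {μ : ℂ // μ ≠ 0}, w μ) := by
    have := hsum.countable_support
    rw [← Set.countable_univ_iff]
    exact this.mono fun p _ => (hpos p).ne'
  have hspan : ∀ i, x i ∈ (Submodule.span ℂ (Set.range v)).topologicalClosure := by
    intro i
    rw [← Submodule.orthogonal_orthogonal_eq_closure, Submodule.mem_orthogonal]
    intro y hy
    rw [Submodule.mem_orthogonal] at hy
    have hker : IsClosed (Module.End.eigenspace (T : Module.End ℂ E) 0 : Set E) := hTc' 0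
    have := hker.completeSpace_coe
    -- A vector `y` orthogonal to all `v p` is split along the kernel of `T`. The part `z` is
    -- orthogonal to all eigenspaces, hence zero by the spectral theorem; the part `y₀` in the
    -- kernel is orthogonal to `x i` by `hinner`.
    obtain ⟨y₀, hy₀, z, hz, rfl⟩ :=
      (Module.End.eigenspace (T : Module.End ℂ E) 0).exists_add_mem_mem_orthogonal y
    have hz0 : z = 0 := by
      have h1 : z ∈ (⨆ μ, Module.End.eigenspace (T : Module.End ℂ E) μ)ᗮ := by
        rw [← Submodule.iInf_orthogonal, Submodule.mem_iInf]
        intro μ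
        by_cases hμ : μ = 0
        · rw [hμ]
          exact hz
        · rw [Submodule.mem_orthogonal']
          intro u hu
          have h1 := (((B μ).hasSum_repr ⟨u, hu⟩).mapL (Submodule.subtypeL _)).mapL (innerSL ℂ z)
          refine h1.unique ?_
          convert hasSum_zero with j
          have h2 : inner ℂ (v ⟨⟨μ, hμ⟩, j⟩) (y₀ + z) = 0 := hy _ (Submodule.subset_span ⟨_, rfl⟩)
          have h3 : inner ℂ (v ⟨⟨μ, hμ⟩, j⟩) y₀ = 0 :=
            hTs.orthogonalFamily_eigenspaces hμ (j : Module.End.eigenspace _ μ) ⟨y₀, hy₀⟩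
          rw [inner_add_right, h3, zero_add] at h2
          have h4 : inner ℂ z (v ⟨⟨μ, hμ⟩, j⟩) = 0 := by rw [← inner_conj_symm, h2, map_zero]
          simp only [map_smul, hB]
          exact smul_eq_zero_of_right _ h4
      rw [ContinuousLinearMap.orthogonalComplement_iSup_eigenspaces_eq_bot hTc hTs] at h1
      simpa using h1
    subst hz0
    rw [add_zero] at hy ⊢
    rw [Module.End.mem_eigenspace_iff, zero_smul] at hy₀
    have h1 := hinner y₀
    change T y₀ = 0 at hy₀
    rw [hy₀, inner_zero_right] at h1
    have h2 := Complex.hasSum_re h1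
    simp only [Complex.ofReal_re, Complex.zero_re] at h2
    have h3 := (hasSum_zero_iff_of_nonneg (fun i => by positivity)).mp h2
    have h4 := congrFun h3 i
    simp only [Pi.zero_apply, ne_eq, OfNat.ofNat_ne_zero, not_false_eq_true, pow_eq_zero_iff,
      norm_eq_zero] at h4
    rw [← inner_conj_symm, h4, map_zero]
  obtain ⟨D, e, φ, hφ, hφe, -⟩ := hv.exists_isPartialOrthonormal
  -- The value `1` beyond `D` keeps `σ` positive everywhere, so that it can be inverted without case
  -- distinctions.
  refine ⟨D, φ, fun a => if h : (a : ℕ∞) < D then √((e ⟨a, h⟩).1 : ℂ).re else 1, hφ, ?_, ?_, ?_, ?_⟩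
  · intro a
    dsimp only
    split_ifs with h
    · exact Real.sqrt_pos.mpr (hpos _)
    · exact one_pos
  · intro a
    by_cases ha : (a : ℕ∞) < D
    · have h1 := hT (φ a)
      have h2 := hφe ⟨a, ha⟩
      dsimp only at h2
      rw [h2] at h1 ⊢
      rw [hTv, (hnorm _).2] at h1
      convert h1 using 2
      simp only [dif_pos ha]
      rw [← Complex.ofReal_pow, Real.sq_sqrt (hpos _).le]
    · simp only [hφ.eq_zero ha, inner_zero_right, zero_smul, smul_zero]
      exact hasSum_zero
  · refine (e.summable_iff.mpr hsum).congr fun a => ?_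
    simp [a.2, Real.sq_sqrt (hpos _).le]
  · intro i
    refine Submodule.topologicalClosure_mono (Submodule.span_mono ?_) (hspan i)
    rintro _ ⟨p, rfl⟩
    exact ⟨e.symm p, by rw [hφe, e.apply_symm_apply]⟩

end Spectral

/-! ## Square summable functions and the Schmidt decomposition -/

section SquareSummable

/-- The Hilbert space of square summable functions. -/
abbrev SqSum (X : Type*) : Type _ := lp (fun _ : X => ℂ) 2

variable {X Y : Type*}

lemma HasSum.of_eqOn {ι E : Type*} [AddCommMonoid E] [TopologicalSpace E] {f g : ι → E} {a : E}
    (h : HasSum f a) (hfg : ∀ i, g i = f i) : HasSum g a := by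
  rwa [funext hfg]

lemma memℓp_two_iff {f : X → ℂ} : Memℓp f 2 ↔ Summable fun i => ‖f i‖ ^ 2 := by
  rw [memℓp_gen_iff (by norm_num)]
  simp

namespace SqSum

lemma hasSum_norm_sq (x : SqSum X) : HasSum (fun i => ‖x i‖ ^ 2) (‖x‖ ^ 2) := by
  have := lp.hasSum_norm (p := 2) (by norm_num) x
  simpa using this

lemma norm_le_of_injective {f : X → Y} (hf : Function.Injective f) (x : SqSum Y) (z : SqSum X)
    (h : ∀ i, z i = x (f i)) : ‖z‖ ≤ ‖x‖ := by
  have h1 := hasSum_norm_sq z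
  have h2 := hasSum_norm_sq x
  simp only [h] at h1
  have h3 : ‖z‖ ^ 2 ≤ ‖x‖ ^ 2 :=
    hasSum_le_inj f hf (fun _ _ => by positivity) (fun _ => le_rfl) h1 h2
  exact (pow_le_pow_iff_left₀ (norm_nonneg _) (norm_nonneg _) two_ne_zero).mp h3

/-- Composition with an injective map. -/
def compL (f : X → Y) (hf : Function.Injective f) : SqSum Y →L[ℂ] SqSum X :=
  LinearMap.mkContinuous
    { toFun := fun x => ⟨fun i => x (f i), memℓp_two_iff.mpr
        ((hasSum_norm_sq x).summable.comp_injective hf)⟩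
      map_add' := fun _ _ => rfl
      map_smul' := fun _ _ => rfl } 1
    (fun x => by
      rw [one_mul]
      exact norm_le_of_injective hf x _ fun i => rfl)

@[simp] lemma compL_apply (f : X → Y) (hf : Function.Injective f) (x : SqSum Y) (i : X) :
    compL f hf x i = x (f i) := rfl

/-- The indicator function of a point. -/
def delta (i : X) : SqSum X := by
  classical exact lp.single 2 i 1

lemma inner_delta (i : X) (x : SqSum X) : inner ℂ (delta i) x = x i := by
  classical
  rw [delta, lp.inner_single_left]
  simp

lemma delta_apply_self (i : X) : delta i i = 1 := by
  classical
  exact lp.single_apply_self (E := fun _ => ℂ) 2 i 1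

lemma delta_apply_ne {i j : X} (h : j ≠ i) : delta i j = 0 := by
  classical
  exact lp.single_apply_ne (E := fun _ => ℂ) 2 i 1 h

lemma orthonormal_delta : Orthonormal ℂ (delta : X → SqSum X) := by
  classical
  rw [orthonormal_iff_ite]
  intro i j
  rw [inner_delta]
  split_ifs with h
  · rw [h, delta_apply_self]
  · exact delta_apply_ne h

lemma eq_zero_of_inner_delta (x : SqSum X) (h : ∀ i, inner ℂ x (delta i) = 0) : x = 0 := by
  ext i
  rw [← inner_delta, ← inner_conj_symm, h, map_zero]
  rfl

lemma hasSum_apply {ι : Type*} {f : ι → SqSum X} {x : SqSum X} (h : HasSum f x) (i : X) :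
    HasSum (fun k => f k i) (x i) := by
  have := h.mapL (innerSL ℂ (delta i))
  simpa only [innerSL_apply_apply, inner_delta] using this

lemma hasSum_inner (x y : SqSum X) : HasSum (fun i => conj (x i) * y i) (inner ℂ x y) := by
  have := lp.hasSum_inner (𝕜 := ℂ) x y
  simpa [mul_comm] using this

/-- Absolute convergence: `‖g i‖ * ‖x i‖` is bounded by the sum of the two squares. -/
lemma summable_smul {E : Type*} [NormedAddCommGroup E] [NormedSpace ℂ E] [CompleteSpace E]
    (x : X → E) (hx : Summable fun i => ‖x i‖ ^ 2) (g : SqSum X) :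
    Summable fun i => conj (g i) • x i := by
  refine Summable.of_norm_bounded ((hasSum_norm_sq g).summable.add hx) fun i => ?_
  rw [norm_smul, RCLike.norm_conj]
  nlinarith [sq_nonneg (‖g i‖ - ‖x i‖), sq_nonneg ‖g i‖, sq_nonneg ‖x i‖]

lemma summable_norm_sq_of_prod (x : Y → SqSum X)
    (h : Summable fun p : Y × X => ‖x p.1 p.2‖ ^ 2) : Summable fun v => ‖x v‖ ^ 2 := by
  have := h.prod
  simpa only [(hasSum_norm_sq _).tsum_eq] using this

end SqSum

open SqSum

/-- The Schmidt decomposition of the matrix with columns `x v` and rows `y u`. -/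
theorem exists_schmidt (x : Y → SqSum X) (y : X → SqSum Y) (hxy : ∀ u v, x v u = y u v)
    (hx : Summable fun v => ‖x v‖ ^ 2) (hy : Summable fun u => ‖y u‖ ^ 2) :
    ∃ (D : ℕ∞) (σ : ℕ → ℝ) (φ : ℕ → SqSum X) (χ : ℕ → SqSum Y),
      IsPartialOrthonormal D φ ∧ IsPartialOrthonormal D χ ∧ (∀ a, 0 < σ a) ∧
      Summable (fun a : {a : ℕ // (a : ℕ∞) < D} => σ a ^ 2) ∧
      (∀ a, HasSum (fun v => conj (χ a v) • x v) ((σ a : ℂ) • φ a)) ∧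
      (∀ a, HasSum (fun u => conj (φ a u) • y u) ((σ a : ℂ) • χ a)) ∧
      (∀ v, x v ∈ (Submodule.span ℂ (Set.range φ)).topologicalClosure) ∧
      (∀ u, y u ∈ (Submodule.span ℂ (Set.range χ)).topologicalClosure) := by
  obtain ⟨D, φ, σ, hφ, hσ, hT, hsum, hspan⟩ := exists_singular_vectors x hx
  have hσ' : ∀ a, (σ a : ℂ) ≠ 0 := fun a => Complex.ofReal_ne_zero.mpr (hσ a).ne'
  -- The partner of a singular vector is its image under the matrix, divided by the singular value.
  -- No conjugate appears on `χ` in `hχ`, as befits the bilinear expansion `x v u = ∑ a, σ a * φ a u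
  -- * χ a v`.
  let χ : ℕ → SqSum Y := fun a => (σ a : ℂ)⁻¹ • ∑' u, conj (φ a u) • y u
  have hB : ∀ a, HasSum (fun u => conj (φ a u) • y u) ((σ a : ℂ) • χ a) := by
    intro a
    have := (summable_smul y hy (φ a)).hasSum
    simpa only [χ, smul_smul, mul_inv_cancel₀ (hσ' a), one_smul] using this
  have hχ : ∀ a v, inner ℂ (φ a) (x v) = σ a * χ a v := by
    intro a v
    have h1 := hasSum_apply (hB a) v
    refine (hasSum_inner (φ a) (x v)).unique ?_
    simp only [hxy]
    exact h1
  have hχ' : ∀ a v, conj (χ a v) = (σ a : ℂ)⁻¹ * inner ℂ (x v) (φ a) := by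
    intro a v
    rw [← inner_conj_symm, hχ, map_mul, Complex.conj_ofReal, inv_mul_cancel_left₀ (hσ' a)]
  -- This is the eigenvector equation for `φ a` divided by `σ a`.
  have hA : ∀ a, HasSum (fun v => conj (χ a v) • x v) ((σ a : ℂ) • φ a) := by
    intro a
    have h1 := (hT a).const_smul (σ a : ℂ)⁻¹
    simp only [smul_smul] at h1
    simp only [hχ']
    convert h1 using 2
    rw [sq, inv_mul_cancel_left₀ (hσ' a)]
  have hχo : IsPartialOrthonormal D χ := by
    intro a b
    have h1 := (hA a).mapL (innerSL ℂ (φ b))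
    simp only [innerSL_apply_apply, inner_smul_right, hχ] at h1
    have h2 := (hasSum_inner (χ a) (χ b)).mul_left (σ b : ℂ)
    -- Both sides equal `∑ v, conj (χ a v) * ⟪φ b, x v⟫`, so orthonormality passes from `φ` to `χ`.
    have h3 : (σ b : ℂ) * inner ℂ (χ a) (χ b) = σ a * inner ℂ (φ b) (φ a) := by
      exact h2.unique (h1.of_eqOn fun v => by ring)
    rw [hφ b a] at h3
    rw [← mul_right_inj' (hσ' b), h3]
    by_cases hab : a = b
    · subst hab; rfl
    · simp [hab, Ne.symm hab]
  refine ⟨D, σ, φ, χ, hφ, hχo, hσ, hsum, hA, hB, hspan, fun u => ?_⟩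
  rw [← Submodule.orthogonal_orthogonal_eq_closure, Submodule.mem_orthogonal]
  intro z hz
  have hz' : ∀ a, inner ℂ z (χ a) = 0 := fun a => by
    rw [← inner_conj_symm, (Submodule.mem_orthogonal _ _).mp hz _ (Submodule.subset_span ⟨a, rfl⟩),
      map_zero]
  -- For `z` orthogonal to every `χ a`, the combination `m` of columns lies in the closed span of
  -- `φ` and is orthogonal to `φ`, hence vanishes; its entry at `u` is `⟪z, y u⟫`.
  obtain ⟨m, hm⟩ := summable_smul x hx z
  have hmspan : m ∈ (Submodule.span ℂ (Set.range φ)).topologicalClosure :=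
    (Submodule.isClosed_topologicalClosure _).mem_of_tendsto hm
      (Filter.Eventually.of_forall fun s => Submodule.sum_mem _ fun v _ =>
        Submodule.smul_mem _ _ (hspan v))
  have hm0 : ∀ a, inner ℂ (φ a) m = 0 := by
    intro a
    have h1 := hm.mapL (innerSL ℂ (φ a))
    simp only [innerSL_apply_apply, inner_smul_right, hχ] at h1
    have h2 := (hasSum_inner z (χ a)).mul_left (σ a : ℂ)
    rw [hz', mul_zero] at h2
    exact h1.unique (h2.of_eqOn fun v => by ring)
  have hmz : m = 0 := by
    have := hφ.hasSum_inner_smul hmspan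
    simp only [hm0, zero_smul] at this
    exact this.unique hasSum_zero
  have h1 := hasSum_apply hm u
  rw [hmz] at h1
  refine (hasSum_inner z (y u)).unique ?_
  simp only [← hxy]
  exact h1

end SquareSummable

open SqSum

/-! ## Wave functions on words -/

section Words

variable {S : Type*}

/-- The partial evaluation `u ↦ x (u ++ w)`. -/
def sliceR (w : List S) : SqSum (List S) →L[ℂ] SqSum (List S) :=
  compL (fun u => u ++ w) (List.append_left_injective w)

/-- The partial evaluation `v ↦ x (w ++ v)`. -/
def sliceL (w : List S) : SqSum (List S) →L[ℂ] SqSum (List S) :=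
  compL (fun v => w ++ v) (List.append_right_injective w)

@[simp] lemma sliceR_apply (w u : List S) (x : SqSum (List S)) : sliceR w x u = x (u ++ w) := rfl

@[simp] lemma sliceL_apply (w v : List S) (x : SqSum (List S)) : sliceL w x v = x (w ++ v) := rfl

lemma sliceR_sliceR (w w' : List S) (x : SqSum (List S)) :
    sliceR w (sliceR w' x) = sliceR (w ++ w') x := by
  ext u; simp

lemma sliceL_sliceL (w w' : List S) (x : SqSum (List S)) :
    sliceL w (sliceL w' x) = sliceL (w' ++ w) x := by
  ext u; simp

/-- The closed linear span of a family of vectors. -/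
abbrev closedSpan {ι E : Type*} [NormedAddCommGroup E] [InnerProductSpace ℂ E] (φ : ι → E) :
    Submodule ℂ E :=
  (Submodule.span ℂ (Set.range φ)).topologicalClosure

lemma mem_closedSpan {ι E : Type*} [NormedAddCommGroup E] [InnerProductSpace ℂ E] (φ : ι → E)
    (i : ι) : φ i ∈ closedSpan φ :=
  Submodule.le_topologicalClosure _ (Submodule.subset_span ⟨i, rfl⟩)

lemma closedSpan_le {ι E : Type*} [NormedAddCommGroup E] [InnerProductSpace ℂ E] {φ : ι → E}
    {U : Submodule ℂ E} (hU : IsClosed (U : Set E)) (h : ∀ i, φ i ∈ U) : closedSpan φ ≤ U :=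
  Submodule.topologicalClosure_minimal _ (Submodule.span_le.mpr (by rintro _ ⟨i, rfl⟩; exact h i)) hU

lemma map_mem_of_mem_closedSpan {ι E F : Type*} [NormedAddCommGroup E] [InnerProductSpace ℂ E]
    [NormedAddCommGroup F] [InnerProductSpace ℂ F] (T : E →L[ℂ] F) {φ : ι → E} {U : Submodule ℂ F}
    (hU : IsClosed (U : Set F)) (h : ∀ i, T (φ i) ∈ U) {x : E} (hx : x ∈ closedSpan φ) :
    T x ∈ U := by
  have hc : IsClosed ((U.comap T.toLinearMap : Submodule ℂ E) : Set E) := hU.preimage T.continuous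
  exact closedSpan_le hc h hx

lemma HasSum.mem_of_isClosed {ι E : Type*} [NormedAddCommGroup E] [InnerProductSpace ℂ E]
    {f : ι → E} {x : E} (h : HasSum f x) {U : Submodule ℂ E} (hU : IsClosed (U : Set E))
    (hf : ∀ i, f i ∈ U) : x ∈ U :=
  hU.mem_of_tendsto h (Filter.Eventually.of_forall fun _ => Submodule.sum_mem _ fun i _ => hf i)

/-- The functions that vanish outside of the set `p`. -/
def vanishingOff {X : Type*} (p : X → Prop) : Submodule ℂ (SqSum X) where
  carrier := {x | ∀ i, ¬ p i → x i = 0}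
  add_mem' := fun {x y} hx hy i hi => by
    rw [lp.coeFn_add, Pi.add_apply, hx i hi, hy i hi, add_zero]
  zero_mem' := fun i _ => rfl
  smul_mem' := fun c x hx i hi => by
    rw [lp.coeFn_smul, Pi.smul_apply, hx i hi, smul_zero]

lemma mem_vanishingOff {X : Type*} {p : X → Prop} {x : SqSum X} :
    x ∈ vanishingOff p ↔ ∀ i, ¬ p i → x i = 0 := Iff.rfl

lemma isClosed_vanishingOff {X : Type*} (p : X → Prop) :
    IsClosed (vanishingOff p : Set (SqSum X)) := by
  have : (vanishingOff p : Set (SqSum X))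
      = ⋂ i, ⋂ (_ : ¬ p i), {x | inner ℂ (delta i) x = 0} := by
    ext x
    simp [mem_vanishingOff, inner_delta]
  rw [this]
  exact isClosed_iInter fun i => isClosed_iInter fun _ =>
    isClosed_eq (by fun_prop) continuous_const

lemma delta_mem_vanishingOff {X : Type*} {p : X → Prop} {i : X} (hi : p i) :
    delta i ∈ vanishingOff p :=
  fun j hj => delta_apply_ne (by rintro rfl; exact hj hi)

variable {N : ℕ} {K : Fin N → Type*}

/-- The word `w` is a configuration of the sites `i, …, i + m - 1`. -/
def IsSegment (i m : ℕ) (w : List (Σ i, K i)) : Prop :=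
  w.map (fun s => (s.1 : ℕ)) = List.range' i m

lemma IsSegment.length_eq {i m : ℕ} {w : List (Σ i, K i)} (h : IsSegment i m w) :
    w.length = m := by
  have := congrArg List.length h
  simpa using this

lemma isSegment_zero {i : ℕ} {w : List (Σ i, K i)} : IsSegment i 0 w ↔ w = [] := by
  simp [IsSegment]

lemma isSegment_cons {i m : ℕ} {s : Σ i, K i} {w : List (Σ i, K i)} :
    IsSegment i (m + 1) (s :: w) ↔ (s.1 : ℕ) = i ∧ IsSegment (i + 1) m w := by
  simp [IsSegment, List.range'_succ]

/-- The length of `u` fixes the place where the list of sites is split. -/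
lemma isSegment_append {i m m' : ℕ} {u v : List (Σ i, K i)} (hu : u.length = m) :
    IsSegment i (m + m') (u ++ v) ↔ IsSegment i m u ∧ IsSegment (i + m) m' v := by
  have h : List.range' i (m + m') = List.range' i m ++ List.range' (i + m) m' := by
    simp
  rw [IsSegment, h, List.map_append]
  exact ⟨fun h' => List.append_inj h' (by simp [hu]), fun h' => by rw [h'.1, h'.2]⟩

/-- The wave functions of the sites `i, …, i + m - 1`. -/
abbrev segmentSpace (K : Fin N → Type*) (i m : ℕ) : Submodule ℂ (SqSum (List (Σ i, K i))) :=
  vanishingOff (IsSegment i m)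

lemma sliceR_mem_segmentSpace {i m n : ℕ} {x : SqSum (List (Σ i, K i))} {w : List (Σ i, K i)}
    (hx : x ∈ segmentSpace K i n) (h : m + w.length = n) : sliceR w x ∈ segmentSpace K i m := by
  intro u hu
  rw [sliceR_apply]
  refine hx _ fun h' => hu ?_
  have hl : u.length = m := by
    have := h'.length_eq
    rw [List.length_append] at this
    omega
  rw [← h, isSegment_append hl] at h'
  exact h'.1

lemma sliceL_mem_segmentSpace {i m n : ℕ} {x : SqSum (List (Σ i, K i))} {w : List (Σ i, K i)}
    (hx : x ∈ segmentSpace K i n) (h : w.length + m = n) :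
    sliceL w x ∈ segmentSpace K (i + w.length) m := by
  intro u hu
  rw [sliceL_apply]
  refine hx _ fun h' => hu ?_
  rw [← h, isSegment_append rfl] at h'
  exact h'.2

/-- The only word on an empty segment is `[]`: this is why the outer bonds have dimension one. -/
lemma eq_smul_delta_of_mem_segmentSpace {i : ℕ} {x : SqSum (List (Σ i, K i))}
    (hx : x ∈ segmentSpace K i 0) : x = x [] • delta [] := by
  ext w
  rw [lp.coeFn_smul, Pi.smul_apply, smul_eq_mul]
  by_cases hw : w = []
  · rw [hw, delta_apply_self, mul_one]
  · rw [delta_apply_ne hw, mul_zero]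
    exact hx w (by rwa [isSegment_zero])

end Words

/-! ## Chains of bond bases -/

section Chains

variable {N : ℕ} {K : Fin N → Type*}

/-- A sequence of at most one nonzero vector. -/
def constSeq {E : Type*} [Zero E] (x : E) (a : ℕ) : E := if a = 0 then x else 0

lemma isPartialOrthonormal_constSeq {E : Type*} [NormedAddCommGroup E] [InnerProductSpace ℂ E]
    {x : E} (hx : ‖x‖ = 1) : IsPartialOrthonormal 1 (constSeq x) := by
  intro a b
  by_cases ha : a = 0
  · by_cases hb : b = 0
    · simp [constSeq, ha, hb, hx]
    · simp [constSeq, ha, hb, Ne.symm hb]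
  · have : ¬ (a : ℕ∞) < 1 := by simpa using ha
    simp [constSeq, ha, this]

/-- Families `φ j` of wave functions of the sites `0, …, j - 1` for `j ≤ n`, orthonormal for
`j < n`, such that all partial evaluations of `φ (j + 1)` are in the closed span of `φ j`. -/
structure IsLeftChain (K : Fin N → Type*) (n : ℕ) (D : ℕ → ℕ∞)
    (φ : ℕ → ℕ → SqSum (List (Σ i, K i))) : Prop where
  start_dim : D 0 = 1
  start : φ 0 = constSeq (delta [])
  zero : ∀ j ≤ n, ∀ a : ℕ, ¬ (a : ℕ∞) < D j → φ j a = 0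
  orthonormal : ∀ j < n, IsPartialOrthonormal (D j) (φ j)
  mem : ∀ j ≤ n, ∀ a, φ j a ∈ segmentSpace K 0 j
  nested : ∀ j < n, ∀ s a, sliceR [s] (φ (j + 1) a) ∈ closedSpan (φ j)

/-- Families `χ j` of wave functions of the sites `j, …, N - 1` for `n ≤ j ≤ N`, orthonormal for
`n < j`, such that all partial evaluations of `χ j` are in the closed span of `χ (j + 1)`. -/
structure IsRightChain (K : Fin N → Type*) (n : ℕ) (D : ℕ → ℕ∞)
    (χ : ℕ → ℕ → SqSum (List (Σ i, K i))) : Prop where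
  final_dim : D N = 1
  final : χ N = constSeq (delta [])
  zero : ∀ j, n ≤ j → j ≤ N → ∀ a : ℕ, ¬ (a : ℕ∞) < D j → χ j a = 0
  orthonormal : ∀ j, n < j → j ≤ N → IsPartialOrthonormal (D j) (χ j)
  mem : ∀ j, n ≤ j → j ≤ N → ∀ a, χ j a ∈ segmentSpace K j (N - j)
  nested : ∀ j, n ≤ j → j < N → ∀ s a, sliceL [s] (χ j a) ∈ closedSpan (χ (j + 1))

/-- The matrices of a left chain. -/
def leftMatrix (φ : ℕ → ℕ → SqSum (List (Σ i, K i))) (s : Σ i, K i) : BondMatrix :=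
  fun a c => inner ℂ (φ s.1 a) (sliceR [s] (φ (s.1 + 1) c))

/-- The matrices of a right chain. -/
def rightMatrix (χ : ℕ → ℕ → SqSum (List (Σ i, K i))) (s : Σ i, K i) : BondMatrix :=
  fun a c => inner ℂ (χ (s.1 + 1) c) (sliceL [s] (χ s.1 a))

/-- The resolution of the identity `∑ |φ c⟩⟨φ c|` on the closed span is inserted after moving `T` to
`x` by the adjoint. With `T` a slice, this is the step that sums out one bond index. -/
lemma IsPartialOrthonormal.hasSum_mul_slice {X Y : Type*} {D : ℕ∞} {φ : ℕ → SqSum X}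
    (h : IsPartialOrthonormal D φ) (T : SqSum X →L[ℂ] SqSum Y) (x : SqSum Y) {y : SqSum X}
    (hy : y ∈ closedSpan φ) :
    HasSum (fun c => inner ℂ x (T (φ c)) * inner ℂ (φ c) y) (inner ℂ x (T y)) := by
  simp only [← ContinuousLinearMap.adjoint_inner_left]
  exact h.hasSum_inner_mul_inner _ hy

lemma IsPartialOrthonormal.hasSum_slice_mul {X Y : Type*} {D : ℕ∞} {φ : ℕ → SqSum X}
    (h : IsPartialOrthonormal D φ) (T : SqSum X →L[ℂ] SqSum Y) (x : SqSum Y) {y : SqSum X}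
    (hy : y ∈ closedSpan φ) :
    HasSum (fun c => inner ℂ (φ c) y * inner ℂ x (T (φ c))) (inner ℂ x (T y)) := by
  exact (h.hasSum_mul_slice T x hy).of_eqOn fun c => mul_comm _ _

/-! ### Parseval identities behind the normalization conditions -/

section Normalization

variable {n : ℕ} {D : ℕ → ℕ∞}

/-- Words on the first `m + 1` sites are a prefix followed by one letter at site `i`. All other
words contribute zero because `x` vanishes there, so only `x` has to be supported on the segment. -/
lemma hasSum_inner_sliceR {m : ℕ} {x y : SqSum (List (Σ i, K i))} {i : Fin N}
    (hi : (i : ℕ) = m) (hx : x ∈ segmentSpace K 0 (m + 1)) :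
    HasSum (fun p : K i × List (Σ i, K i) => conj (x (p.2 ++ [⟨i, p.1⟩])) * y (p.2 ++ [⟨i, p.1⟩]))
      (inner ℂ x y) := by
  have h := hasSum_inner x y
  have hinj : Function.Injective fun p : K i × List (Σ i, K i) => p.2 ++ [(⟨i, p.1⟩ : Σ i, K i)] := by
    rintro ⟨k, u⟩ ⟨k', u'⟩ huu
    have := List.append_inj' huu rfl
    simp_all
  refine (hinj.hasSum_iff fun w hw => ?_).mpr h
  rw [hx w, map_zero, zero_mul]
  intro hseg
  refine hw ?_
  obtain ⟨u, s, rfl⟩ : ∃ u s, w = u ++ [s] := by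
    have : w ≠ [] := by rintro rfl; simpa using hseg.length_eq
    exact ⟨_, _, (List.dropLast_append_getLast this).symm⟩
  have hlen : u.length = m := by simpa using hseg.length_eq
  rw [isSegment_append hlen, isSegment_cons, zero_add] at hseg
  obtain ⟨j, k⟩ := s
  obtain rfl : j = i := Fin.ext (hseg.2.1.trans hi.symm)
  exact ⟨(k, u), rfl⟩

lemma hasSum_inner_sliceL {j m : ℕ} {x y : SqSum (List (Σ i, K i))} {i : Fin N}
    (hi : (i : ℕ) = j) (hx : x ∈ segmentSpace K j (m + 1)) :
    HasSum (fun p : K i × List (Σ i, K i) => conj (x (⟨i, p.1⟩ :: p.2)) * y (⟨i, p.1⟩ :: p.2))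
      (inner ℂ x y) := by
  have h := hasSum_inner x y
  have hinj : Function.Injective fun p : K i × List (Σ i, K i) => (⟨i, p.1⟩ : Σ i, K i) :: p.2 := by
    rintro ⟨k, u⟩ ⟨k', u'⟩ huu
    simp_all
  refine (hinj.hasSum_iff fun w hw => ?_).mpr h
  rw [hx w, map_zero, zero_mul]
  intro hseg
  refine hw ?_
  cases w with
  | nil => simpa using hseg.length_eq
  | cons s u =>
  rw [isSegment_cons] at hseg
  obtain ⟨i', k⟩ := s
  obtain rfl : i' = i := Fin.ext (hseg.1.trans hi.symm)
  exact ⟨(k, u), rfl⟩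

lemma hasSum_inner_slices_sliceR {m : ℕ} {x y : SqSum (List (Σ i, K i))} {i : Fin N}
    (hi : (i : ℕ) = m) (hx : x ∈ segmentSpace K 0 (m + 1)) :
    HasSum (fun k : K i => inner ℂ (sliceR [⟨i, k⟩] x) (sliceR [⟨i, k⟩] y)) (inner ℂ x y) :=
  (hasSum_inner_sliceR hi hx).prod_fiberwise fun k => by
    have := hasSum_inner (sliceR [⟨i, k⟩] x) (sliceR [⟨i, k⟩] y)
    simp only [sliceR_apply] at this
    exact this

lemma hasSum_inner_slices_sliceL {j m : ℕ} {x y : SqSum (List (Σ i, K i))} {i : Fin N}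
    (hi : (i : ℕ) = j) (hx : x ∈ segmentSpace K j (m + 1)) :
    HasSum (fun k : K i => inner ℂ (sliceL [⟨i, k⟩] x) (sliceL [⟨i, k⟩] y)) (inner ℂ x y) :=
  (hasSum_inner_sliceL hi hx).prod_fiberwise fun k => by
    have := hasSum_inner (sliceL [⟨i, k⟩] x) (sliceL [⟨i, k⟩] y)
    simp only [sliceL_apply, List.singleton_append] at this
    exact this

lemma summable_norm_sq_of_hasSum_inner_self {κ E : Type*} [NormedAddCommGroup E]
    [InnerProductSpace ℂ E] {x : κ → E} {T : ℂ} (h : HasSum (fun k => inner ℂ (x k) (x k)) T) :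
    Summable fun k => ‖x k‖ ^ 2 := by
  have := (Complex.hasSum_re h).summable
  refine this.congr fun k => ?_
  rw [inner_self_eq_norm_sq_to_K]
  norm_cast

/-- Parseval's identity for a direct sum of copies of a Hilbert space. -/
lemma IsPartialOrthonormal.hasSum_prod {κ E : Type*} [NormedAddCommGroup E]
    [InnerProductSpace ℂ E] [CompleteSpace E] {D : ℕ∞} {φ : ℕ → E}
    (h : IsPartialOrthonormal D φ) {x y : κ → E} (hx : ∀ k, x k ∈ closedSpan φ)
    (hy : ∀ k, y k ∈ closedSpan φ) (hxs : Summable fun k => ‖x k‖ ^ 2)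
    (hys : Summable fun k => ‖y k‖ ^ 2) {T : ℂ} (hT : HasSum (fun k => inner ℂ (x k) (y k)) T) :
    HasSum (fun p : κ × ℕ => conj (inner ℂ (φ p.2) (x p.1)) * inner ℂ (φ p.2) (y p.1)) T := by
  have hfib : ∀ (z : κ → E), (∀ k, z k ∈ closedSpan φ) → ∀ k,
      HasSum (fun a => ‖inner ℂ (φ a) (z k)‖ ^ 2) (‖z k‖ ^ 2) := by
    intro z hz k
    have h1 := Complex.hasSum_re (h.hasSum_inner_mul_inner (z k) (hz k))
    rw [inner_self_eq_norm_sq_to_K] at h1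
    norm_cast at h1
    refine h1.of_eqOn fun a => ?_
    rw [← inner_conj_symm (z k), Complex.conj_mul']
    norm_cast
  have hsum : ∀ (z : κ → E), (∀ k, z k ∈ closedSpan φ) → (Summable fun k => ‖z k‖ ^ 2) →
      Summable fun p : κ × ℕ => ‖inner ℂ (φ p.2) (z p.1)‖ ^ 2 := by
    intro z hz hzs
    refine (summable_prod_of_nonneg fun p => by positivity).mpr
      ⟨fun k => (hfib z hz k).summable, ?_⟩
    simpa only [(hfib z hz _).tsum_eq] using hzs
  -- The sum over pairs has to converge unconditionally, hence absolutely. Tonelli and Parseval give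
  -- square summability of each factor, and the iterated sum then identifies the value.
  have hs : Summable fun p : κ × ℕ =>
      conj (inner ℂ (φ p.2) (x p.1)) * inner ℂ (φ p.2) (y p.1) := by
    refine Summable.of_norm_bounded ((hsum x hx hxs).add (hsum y hy hys)) fun p => ?_
    rw [norm_mul, RCLike.norm_conj]
    nlinarith [sq_nonneg (‖inner ℂ (φ p.2) (x p.1)‖ - ‖inner ℂ (φ p.2) (y p.1)‖),
      sq_nonneg ‖inner ℂ (φ p.2) (x p.1)‖, sq_nonneg ‖inner ℂ (φ p.2) (y p.1)‖]
  have h1 := hs.hasSum.prod_fiberwise (g := fun k => inner ℂ (x k) (y k)) fun k => by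
    simpa only [inner_conj_symm] using h.hasSum_inner_mul_inner (x k) (hy k)
  rw [← h1.unique hT]
  exact hs.hasSum

/-- Left normalization of the matrices of a left chain. -/
lemma IsLeftChain.hasSum_leftMatrix {φ : ℕ → ℕ → SqSum (List (Σ i, K i))}
    (h : IsLeftChain K n D φ) {i : Fin N} (hi : (i : ℕ) < n) (c c' : ℕ) :
    HasSum (fun p : K i × ℕ => conj (leftMatrix φ ⟨i, p.1⟩ p.2 c) * leftMatrix φ ⟨i, p.1⟩ p.2 c')
      (inner ℂ (φ (i + 1) c) (φ (i + 1) c')) := by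
  have hm := h.mem (i + 1) hi
  exact (h.orthonormal i hi).hasSum_prod (fun k => h.nested i hi ⟨i, k⟩ c)
    (fun k => h.nested i hi ⟨i, k⟩ c')
    (summable_norm_sq_of_hasSum_inner_self (hasSum_inner_slices_sliceR rfl (hm c)))
    (summable_norm_sq_of_hasSum_inner_self (hasSum_inner_slices_sliceR rfl (hm c')))
    (hasSum_inner_slices_sliceR rfl (hm c))

/-- Right normalization of the matrices of a right chain. -/
lemma IsRightChain.hasSum_rightMatrix {χ : ℕ → ℕ → SqSum (List (Σ i, K i))}
    (h : IsRightChain K n D χ) {i : Fin N} (hi : n ≤ (i : ℕ)) (c c' : ℕ) :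
    HasSum (fun p : K i × ℕ =>
      rightMatrix χ ⟨i, p.1⟩ c p.2 * conj (rightMatrix χ ⟨i, p.1⟩ c' p.2))
      (inner ℂ (χ i c') (χ i c)) := by
  have hm := h.mem i hi i.2.le
  obtain ⟨m, hN⟩ : ∃ m, N - i = m + 1 := ⟨N - i - 1, by omega⟩
  rw [hN] at hm
  have := (h.orthonormal (i + 1) (by omega) i.2).hasSum_prod
    (fun k => h.nested i hi i.2 ⟨i, k⟩ c') (fun k => h.nested i hi i.2 ⟨i, k⟩ c)
    (summable_norm_sq_of_hasSum_inner_self (hasSum_inner_slices_sliceL rfl (hm c')))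
    (summable_norm_sq_of_hasSum_inner_self (hasSum_inner_slices_sliceL rfl (hm c)))
    (hasSum_inner_slices_sliceL rfl (hm c'))
  exact this.of_eqOn fun p => mul_comm _ _

end Normalization

end Chains

/-! ## Matrix products of chains -/

section Products

/-- Here `f i` plays the role of the product of the factors from position `i` on. The hypothesis
multiplies by one more factor from the left, which matches the nesting of the sums in
`IsMatrixProduct`. -/
lemma isMatrixProduct_ofFn {m : ℕ} (F : Fin (m + 1) → BondMatrix) (f : ℕ → BondMatrix)
    (hstep : ∀ (i : ℕ) (h : i < m) (a b : ℕ),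
      HasSum (fun c => F ⟨i, h.trans m.lt_succ_self⟩ a c * f (i + 1) c b) (f i a b))
    (hlast : f m = F (Fin.last m)) : IsMatrixProduct (List.ofFn F) (f 0) := by
  induction m generalizing f with
  | zero =>
    simp only [List.ofFn_succ, List.ofFn_zero]
    exact hlast
  | succ m ih =>
    have h1 := ih (fun i => F i.succ) (fun i => f (i + 1))
      (fun i h a b => hstep (i + 1) (by omega) a b) hlast
    rw [List.ofFn_succ]
    rw [List.ofFn_succ] at h1 ⊢
    exact ⟨_, h1, fun a b => hstep 0 (by omega) a b⟩

lemma drop_ofFn {α : Type*} {m : ℕ} (s : Fin m → α) {i : ℕ} (h : i < m) :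
    (List.ofFn s).drop i = s ⟨i, h⟩ :: (List.ofFn s).drop (i + 1) := by
  rw [List.drop_eq_getElem_cons (by simpa using h)]
  simp

variable {N : ℕ} {K : Fin N → Type*} {n : ℕ} {D : ℕ → ℕ∞}

/-- The letters of `v` are contracted from the right end. The last `l` of them bring `y` into the
span at bond `n`, and each further one moves down one bond by nesting. The uses have `l = 0` for a
member of the last family and `l = N - n` for the full state. -/
lemma IsLeftChain.sliceR_mem {φ : ℕ → ℕ → SqSum (List (Σ i, K i))} (h : IsLeftChain K n D φ)
    {y : SqSum (List (Σ i, K i))} {l : ℕ}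
    (hy : ∀ v, v.length = l → sliceR v y ∈ closedSpan (φ n)) {j : ℕ} (hj : j ≤ n) :
    ∀ v, v.length + j = l + n → sliceR v y ∈ closedSpan (φ j) := by
  obtain ⟨k, rfl⟩ := Nat.exists_eq_add_of_le hj
  clear hj
  induction k generalizing j with
  | zero => intro v hv; exact hy v (by omega)
  | succ k ih =>
    intro v hv
    cases v with
    | nil => simp at hv; omega
    | cons s v =>
    have h1 : sliceR v y ∈ closedSpan (φ (j + 1)) := by
      have e : j + 1 + k = j + (k + 1) := by omega
      refine ih (j := j + 1) (by rwa [e]) (by rwa [e]) v ?_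
      simp at hv
      omega
    rw [← List.singleton_append, ← sliceR_sliceR]
    exact map_mem_of_mem_closedSpan _ (Submodule.isClosed_topologicalClosure _)
      (h.nested j (by omega) s) h1

lemma IsPartialOrthonormal.hasSum_leftMatrix_mul {D : ℕ∞}
    {φ : ℕ → ℕ → SqSum (List (Σ i, K i))} {s : Σ i, K i} {j : ℕ} (hs : (s.1 : ℕ) = j)
    (h : IsPartialOrthonormal D (φ (j + 1))) (a : ℕ) {y : SqSum (List (Σ i, K i))}
    (hy : y ∈ closedSpan (φ (j + 1))) :
    HasSum (fun c => leftMatrix φ s a c * inner ℂ (φ (j + 1) c) y)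
      (inner ℂ (φ j a) (sliceR [s] y)) := by
  subst hs
  exact h.hasSum_mul_slice (sliceR [s]) (φ s.1 a) hy

/-- The matrix products of a left chain, with the weights `σ` of the bonds moved to the right. -/
lemma IsLeftChain.isMatrixProduct {φ : ℕ → ℕ → SqSum (List (Σ i, K i))}
    (h : IsLeftChain K n D φ) (hn : 0 < n) (s : Fin n → Σ i, K i) (hs : ∀ i, ((s i).1 : ℕ) = i)
    (σ : ℕ → ℕ → ℂ) (hσ : ∀ j a, σ j a ≠ 0) :
    IsMatrixProduct (List.ofFn fun i a c => (σ i a)⁻¹ * leftMatrix φ (s i) a c *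
        (if (i : ℕ) + 1 < n then σ (i + 1) c else 1))
      (fun a b => (σ 0 a)⁻¹ * inner ℂ (φ 0 a) (sliceR (List.ofFn s) (φ n b))) := by
  obtain ⟨m, rfl⟩ := Nat.exists_eq_succ_of_ne_zero hn.ne'
  -- The factor `(σ i a)⁻¹` is what the telescoping leaves: the inverse weight at bond `i + 1`
  -- cancels against the weight to the right of factor `i`.
  let f : ℕ → BondMatrix := fun i a b =>
    (σ i a)⁻¹ * inner ℂ (φ i a) (sliceR ((List.ofFn s).drop i) (φ (m + 1) b))
  refine isMatrixProduct_ofFn _ f (fun i hi a b => ?_) ?_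
  · have hy : sliceR ((List.ofFn s).drop (i + 1)) (φ (m + 1) b) ∈ closedSpan (φ (i + 1)) := by
      refine h.sliceR_mem (l := 0) (fun v hv => ?_) (by omega) _ (by simp; omega)
      rw [List.length_eq_zero_iff.mp hv]
      convert mem_closedSpan (φ (m + 1)) b using 1
      ext u; simp
    have h1 := (h.orthonormal (i + 1) (by omega)).hasSum_leftMatrix_mul
      (hs ⟨i, by omega⟩) a hy
    rw [sliceR_sliceR, List.singleton_append, ← drop_ofFn s] at h1
    refine (h1.mul_left (σ i a)⁻¹).of_eqOn fun c => ?_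
    have : i + 1 < m + 1 := by omega
    simp only [f, this, if_true]
    field_simp [hσ]
  · ext a c
    have hd : (List.ofFn s).drop m = [s (Fin.last m)] := by
      rw [drop_ofFn s m.lt_succ_self, List.drop_of_length_le (by simp)]
      rfl
    have h1 := hs (Fin.last m)
    simp only [Fin.val_last] at h1
    simp [f, hd, leftMatrix, h1, -List.ofFn_succ]

lemma IsPartialOrthonormal.hasSum_rightMatrix_mul {D : ℕ∞}
    {χ : ℕ → ℕ → SqSum (List (Σ i, K i))} {s : Σ i, K i} {j : ℕ} (hs : (s.1 : ℕ) = j)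
    (h : IsPartialOrthonormal D (χ (j + 1))) (a : ℕ) (x : SqSum (List (Σ i, K i)))
    (w : List (Σ i, K i)) (hy : sliceL [s] (χ j a) ∈ closedSpan (χ (j + 1))) :
    HasSum (fun c => rightMatrix χ s a c * inner ℂ x (sliceL w (χ (j + 1) c)))
      (inner ℂ x (sliceL (s :: w) (χ j a))) := by
  subst hs
  have := h.hasSum_slice_mul (sliceL w) x hy
  rwa [sliceL_sliceL] at this

/-- The matrix products of a right chain. -/
lemma IsRightChain.isMatrixProduct {χ : ℕ → ℕ → SqSum (List (Σ i, K i))}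
    (h : IsRightChain K n D χ) {m : ℕ} (hm : 0 < m) (hN : n + m = N) (s : Fin m → Σ i, K i)
    (hs : ∀ i, ((s i).1 : ℕ) = n + i) :
    IsMatrixProduct (List.ofFn fun i => rightMatrix χ (s i))
      (fun a b => inner ℂ (χ N b) (sliceL (List.ofFn s) (χ n a))) := by
  obtain ⟨m, rfl⟩ := Nat.exists_eq_succ_of_ne_zero hm.ne'
  -- The remaining word is contracted with the vector `a` of bond `n + i`, leaving an overlap at the
  -- final bond.
  let f : ℕ → BondMatrix := fun i a b =>
    inner ℂ (χ N b) (sliceL ((List.ofFn s).drop i) (χ (n + i) a))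
  refine isMatrixProduct_ofFn _ f (fun i hi a b => ?_) ?_
  · have h1 := (h.orthonormal (n + i + 1) (by omega) (by omega)).hasSum_rightMatrix_mul
      (hs ⟨i, by omega⟩) a (χ N b) ((List.ofFn s).drop (i + 1))
      (h.nested _ (by simp) (by simp; omega) _ _)
    rwa [← drop_ofFn s] at h1
  · ext a c
    have hd : (List.ofFn s).drop m = [s (Fin.last m)] := by
      rw [drop_ofFn s m.lt_succ_self, List.drop_of_length_le (by simp)]
      rfl
    have h1 := hs (Fin.last m)
    simp only [Fin.val_last] at h1
    have h2 : n + m + 1 = N := by omega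
    simp only [f, hd, rightMatrix, h1, h2]

/-- The matrix products of a left chain up to the bond `n`, followed by diagonal weights `d` and
by a right chain. -/
lemma isMatrixProduct_mixed {φ χ : ℕ → ℕ → SqSum (List (Σ i, K i))} {D' : ℕ → ℕ∞}
    (h : IsLeftChain K n D φ) (hφ : IsPartialOrthonormal (D n) (φ n))
    (h' : IsRightChain K n D' χ) (hn : 0 < n) (hnN : n < N) (d : ℕ → ℂ)
    {ψ : SqSum (List (Σ i, K i))}
    (hmem : ∀ v, v.length + n = N → sliceR v ψ ∈ closedSpan (φ n))
    (hd : ∀ a v, v.length + n = N → inner ℂ (φ n a) (sliceR v ψ) = d a * χ n a v)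
    (s : Fin N → Σ i, K i) (hs : ∀ i, ((s i).1 : ℕ) = i) :
    IsMatrixProduct (List.ofFn fun i a c =>
        (if (i : ℕ) < n then leftMatrix φ (s i) a c else rightMatrix χ (s i) a c) *
        (if (i : ℕ) + 1 = n then d c else 1))
      (fun a b => inner ℂ (φ 0 a) (sliceR (List.ofFn s) (constSeq ψ b))) := by
  obtain ⟨m, rfl⟩ := Nat.exists_eq_succ_of_ne_zero (hn.trans hnN).ne'
  -- To the left of the cut, the partial product is an overlap of `φ i` with a slice of `ψ`; from
  -- bond `n` on, it is a coefficient of `χ i`. The sequence `constSeq ψ` supplies the dummy column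
  -- index.
  let f : ℕ → BondMatrix := fun i a b =>
    if i < n then inner ℂ (φ i a) (sliceR ((List.ofFn s).drop i) (constSeq ψ b))
    else inner ℂ (χ (m + 1) b) (sliceL ((List.ofFn s).drop i) (χ i a))
  have hf0 : f 0 = fun a b => inner ℂ (φ 0 a) (sliceR (List.ofFn s) (constSeq ψ b)) := by
    simp [f, hn]
  rw [← hf0]
  have hmem' : ∀ b v, v.length = m + 1 - n → sliceR v (constSeq ψ b) ∈ closedSpan (φ n) := by
    intro b v hv
    by_cases hb : b = 0
    · simpa [constSeq, hb] using hmem v (by omega)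
    · simp [constSeq, hb]
  refine isMatrixProduct_ofFn _ f (fun i hi a b => ?_) ?_
  · rcases lt_trichotomy (i + 1) n with hin | hin | hin
    · have hy : sliceR ((List.ofFn s).drop (i + 1)) (constSeq ψ b) ∈ closedSpan (φ (i + 1)) :=
        h.sliceR_mem (hmem' b) hin.le _ (by simp; omega)
      have h1 := (h.orthonormal (i + 1) hin).hasSum_leftMatrix_mul (hs ⟨i, by omega⟩) a hy
      rw [sliceR_sliceR, List.singleton_append, ← drop_ofFn s] at h1
      have h2 : i < n := by omega
      have h3 : i + 1 ≠ n := by omega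
      simpa [f, hin, h2, h3] using h1
    -- At the cut the two descriptions meet: Parseval sums over `φ n`, and `hd` replaces each
    -- overlap with the slice of `ψ` by the weight times a coefficient of `χ n`.
    · have hl : ((List.ofFn s).drop (i + 1)).length = m + 1 - n := by simp; omega
      have hy := hmem' b _ hl
      subst hin
      have h1 := hφ.hasSum_leftMatrix_mul (hs ⟨i, by omega⟩) a hy
      rw [sliceR_sliceR, List.singleton_append, ← drop_ofFn s] at h1
      simp only [f, lt_irrefl, if_false, lt_add_iff_pos_right, zero_lt_one, if_true]
      refine h1.of_eqOn fun c => ?_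
      rw [mul_assoc, h'.final]
      congr 1
      by_cases hb : b = 0
      · simp only [constSeq, hb, if_true, inner_delta, sliceL_apply, List.append_nil]
        rw [hd _ _ (by rw [hl]; omega)]
      · simp [constSeq, hb]
    · have h1 := (h'.orthonormal (i + 1) hin (by omega)).hasSum_rightMatrix_mul
        (hs ⟨i, by omega⟩) a (χ (m + 1) b) ((List.ofFn s).drop (i + 1))
        (h'.nested i (by omega) (by omega) _ _)
      rw [← drop_ofFn s] at h1
      have h2 : ¬ i < n := by omega
      have h3 : i + 1 ≠ n := by omega
      have h4 : ¬ i + 1 < n := by omega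
      simpa [f, h2, h3, h4] using h1
  · ext a c
    have hd : (List.ofFn s).drop m = [s (Fin.last m)] := by
      rw [drop_ofFn s m.lt_succ_self, List.drop_of_length_le (by simp)]
      rfl
    have h1 := hs (Fin.last m)
    simp only [Fin.val_last] at h1
    have h2 : ¬ m < n := by omega
    have h3 : m + 1 ≠ n := by omega
    simp [f, hd, rightMatrix, h1, h2, h3, -List.ofFn_succ]

end Products

/-! ## The product basis of the Hilbert space tensor product -/

section ProductBasis

variable {ι : Type*} [Fintype ι] {H : ι → Type*}
  [∀ i, NormedAddCommGroup (H i)] [∀ i, InnerProductSpace ℂ (H i)]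

lemma inner_joinTensor {κ₁ κ₂ : Type*} [Fintype κ₁] [Fintype κ₂] (e : κ₁ ⊕ κ₂ ≃ ι)
    (x x' : HilbertTensor fun i => H (e (Sum.inl i)))
    (y y' : HilbertTensor fun j => H (e (Sum.inr j))) :
    inner ℂ (joinTensor H e x y) (joinTensor H e x' y') = inner ℂ x x' * inner ℂ y y' := by
  induction x, x' using UniformSpace.Completion.induction_on₂ with
  | hp => exact isClosed_eq (by fun_prop) (by fun_prop)
  | ih s s' =>
  induction y, y' using UniformSpace.Completion.induction_on₂ with
  | hp => exact isClosed_eq (by fun_prop) (by fun_prop)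
  | ih t t' =>
  rw [joinTensor_coe, joinTensor_coe, UniformSpace.Completion.inner_coe,
    UniformSpace.Completion.inner_coe, UniformSpace.Completion.inner_coe, AlgTensor.inner_join]

lemma norm_pureTensor (x : ∀ i, H i) : ‖pureTensor x‖ = ∏ i, ‖x i‖ := by
  have h := inner_pureTensor x x
  simp only [inner_self_eq_norm_sq_to_K] at h
  have h' : ‖pureTensor x‖ ^ 2 = (∏ i, ‖x i‖) ^ 2 := by
    rw [← Finset.prod_pow]
    exact_mod_cast h
  exact (pow_left_inj₀ (norm_nonneg _) (by positivity) two_ne_zero).mp h'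

/-- `pureTensor` is continuous and linear in each variable. -/
lemma exists_pureTensor_update [DecidableEq ι] (x : ∀ i, H i) (i : ι) :
    ∃ T : H i →L[ℂ] HilbertTensor H, ∀ h, T h = pureTensor (Function.update x i h) := by
  let L : H i →ₗ[ℂ] HilbertTensor H :=
    (UniformSpace.Completion.toComplL (𝕜 := ℂ) (E := AlgTensor H)).toLinearMap ∘ₗ
      ((PiTensorProduct.tprod ℂ (s := H)).toLinearMap x i : H i →ₗ[ℂ] AlgTensor H)
  have hL : ∀ h, L h = pureTensor (Function.update x i h) := fun h => rfl
  refine ⟨L.mkContinuous (∏ j ∈ Finset.univ.erase i, ‖x j‖) fun h => ?_, hL⟩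
  rw [hL, norm_pureTensor, ← Finset.mul_prod_erase Finset.univ _ (Finset.mem_univ i), mul_comm]
  refine le_of_eq ?_
  congr 1
  · exact Finset.prod_congr rfl fun j hj => by
      rw [Function.update_of_ne (Finset.ne_of_mem_erase hj)]
  · simp

variable {K : ι → Type*}

/-- Basis vectors are replaced by arbitrary vectors one slot at a time; each replacement expands the
slot in its basis and uses continuity and linearity there. -/
lemma inner_pureTensor_eq_zero_of_basis (b : ∀ i, HilbertBasis (K i) ℂ (H i)) (y : HilbertTensor H)
    (hy : ∀ k : ∀ i, K i, inner ℂ y (pureTensor fun i => b i (k i)) = 0) (x : ∀ i, H i) :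
    inner ℂ y (pureTensor x) = 0 := by
  classical
  -- The set `s` collects the slots that may hold arbitrary vectors.
  suffices h : ∀ (s : Finset ι) (x : ∀ i, H i), (∀ i ∉ s, x i ∈ Set.range (b i)) →
      inner ℂ y (pureTensor x) = 0 from h Finset.univ x fun i hi => (hi (Finset.mem_univ i)).elim
  intro s
  induction s using Finset.induction_on with
  | empty =>
    intro x hx
    choose k hk using fun i => hx i (Finset.notMem_empty i)
    obtain rfl : (fun i => b i (k i)) = x := funext hk
    exact hy k
  | insert i s hi ih =>
    intro x hx
    obtain ⟨T, hT⟩ := exists_pureTensor_update x i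
    have h1 := (((b i).hasSum_repr (x i)).mapL T).mapL (innerSL ℂ y)
    have h2 : ∀ k, inner ℂ y (T (b i k)) = 0 := by
      intro k
      rw [hT]
      refine ih _ fun j hj => ?_
      by_cases hji : j = i
      · subst hji; simp
      · rw [Function.update_of_ne hji]
        exact hx j (by simp [hj, hji])
    simp only [map_smul, innerSL_apply_apply, h2, smul_zero] at h1
    rw [hT, Function.update_eq_self] at h1
    exact h1.unique hasSum_zero

lemma orthonormal_pureTensor (b : ∀ i, HilbertBasis (K i) ℂ (H i)) :
    Orthonormal ℂ fun k : ∀ i, K i => pureTensor fun i => b i (k i) := by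
  classical
  rw [orthonormal_iff_ite]
  intro k l
  rw [inner_pureTensor]
  by_cases h : k = l
  · subst h
    simp [(b _).orthonormal.1]
  · rw [if_neg h]
    obtain ⟨i, hi⟩ := Function.ne_iff.mp h
    exact Finset.prod_eq_zero (Finset.mem_univ i) ((b i).orthonormal.2 hi)

/-- The product basis. -/
def productBasis (b : ∀ i, HilbertBasis (K i) ℂ (H i)) :
    HilbertBasis (∀ i, K i) ℂ (HilbertTensor H) :=
  HilbertBasis.mkOfOrthogonalEqBot (orthonormal_pureTensor b) (by
    rw [Submodule.eq_bot_iff]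
    intro y hy
    rw [Submodule.mem_orthogonal'] at hy
    -- Orthogonality passes from basis tensors to elementary tensors, then by linearity to the
    -- algebraic tensor product, then by density to the completion.
    have h1 := inner_pureTensor_eq_zero_of_basis b y fun k => hy _ (Submodule.subset_span ⟨k, rfl⟩)
    have h2 : ∀ t : AlgTensor H, inner ℂ y (t : HilbertTensor H) = 0 := by
      intro t
      induction t using AlgTensor.induction with
      | h1 r x =>
        rw [UniformSpace.Completion.coe_smul, inner_smul_right]
        exact mul_eq_zero_of_right _ (h1 x)
      | h2 s t hs ht => rw [UniformSpace.Completion.coe_add, inner_add_right, hs, ht, add_zero]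
    have h3 : ∀ z : HilbertTensor H, inner ℂ y z = 0 := by
      intro z
      induction z using UniformSpace.Completion.induction_on with
      | hp => exact isClosed_eq (by fun_prop) continuous_const
      | ih t => exact h2 t
    exact inner_self_eq_zero.mp (h3 y))

lemma productBasis_apply (b : ∀ i, HilbertBasis (K i) ℂ (H i)) (k : ∀ i, K i) :
    productBasis b k = pureTensor fun i => b i (k i) := by
  simp [productBasis]

end ProductBasis

/-! ## Vectors with given wave functions -/

section WaveFunctions

variable {N : ℕ} {K : Fin N → Type*}

/-- A configuration of the sites `e 0, …, e (m - 1)` as a word. -/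
def configWord {m : ℕ} (e : Fin m → Fin N) (k : ∀ i, K (e i)) : List (Σ i, K i) :=
  List.ofFn fun i => ⟨e i, k i⟩

lemma configWord_injective {m : ℕ} (e : Fin m → Fin N) :
    Function.Injective (configWord e : (∀ i, K (e i)) → List (Σ i, K i)) := by
  intro k l h
  funext i
  have := congrFun (List.ofFn_injective h) i
  simpa using this

lemma isSegment_iff_exists_configWord {m i₀ : ℕ} {e : Fin m → Fin N}
    (he : ∀ i, (e i : ℕ) = i₀ + i) {w : List (Σ i, K i)} :
    IsSegment i₀ m w ↔ ∃ k, configWord e k = w := by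
  constructor
  · intro h
    have hl := h.length_eq
    subst hl
    have h1 : ∀ i : Fin w.length, ∃ k : K (e i), ⟨e i, k⟩ = w[i] := by
      intro i
      have h2 : ((w[i].1 : Fin N) : ℕ) = i₀ + i := by
        have := List.getElem_of_eq h (i := i) (by simp)
        simpa using this
      -- The segment condition determines the site of each letter, so its basis index can be
      -- transported to `K (e i)`.
      have h3 : w[i].1 = e i := Fin.ext (h2.trans (he i).symm)
      exact ⟨h3 ▸ w[i].2, Sigma.ext h3.symm (by simp)⟩
    choose k hk using h1
    refine ⟨k, ?_⟩
    simp only [configWord, hk]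
    exact List.ofFn_getElem
  · rintro ⟨k, rfl⟩
    refine List.ext_getElem (by simp [configWord]) fun i h1 h2 => ?_
    simp [configWord, he]

variable {H : Fin N → Type*}
  [∀ i, NormedAddCommGroup (H i)] [∀ i, InnerProductSpace ℂ (H i)]

/-- The vector with the wave function `x`. -/
def ofWave (b : ∀ i, HilbertBasis (K i) ℂ (H i)) {m : ℕ} (e : Fin m → Fin N)
    (x : SqSum (List (Σ i, K i))) : HilbertTensor fun i => H (e i) :=
  (productBasis fun i => b (e i)).repr.symm (compL (configWord e) (configWord_injective e) x)

lemma hasSum_ofWave (b : ∀ i, HilbertBasis (K i) ℂ (H i)) {m : ℕ} (e : Fin m → Fin N)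
    (x : SqSum (List (Σ i, K i))) :
    HasSum (fun k => x (configWord e k) • ket (fun i => b (e i)) k) (ofWave b e x) := by
  refine ((productBasis fun i => b (e i)).hasSum_repr_symm
    (compL (configWord e) (configWord_injective e) x)).of_eqOn fun k => ?_
  rw [productBasis_apply]
  rfl

lemma inner_ket_ofWave (b : ∀ i, HilbertBasis (K i) ℂ (H i)) {m : ℕ} (e : Fin m → Fin N)
    (x : SqSum (List (Σ i, K i))) (k : ∀ i, K (e i)) :
    inner ℂ (ket (fun i => b (e i)) k) (ofWave b e x) = x (configWord e k) := by
  have := (productBasis fun i => b (e i)).repr_apply_apply (ofWave b e x) k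
  rw [productBasis_apply] at this
  rw [ket, ← this, ofWave, LinearIsometryEquiv.apply_symm_apply]
  rfl

/-- Restriction to configuration words loses nothing in the inner product, since `x` vanishes on all
other words. -/
lemma inner_ofWave (b : ∀ i, HilbertBasis (K i) ℂ (H i)) {m i₀ : ℕ} {e : Fin m → Fin N}
    (he : ∀ i, (e i : ℕ) = i₀ + i) {x : SqSum (List (Σ i, K i))} (hx : x ∈ segmentSpace K i₀ m)
    (y : SqSum (List (Σ i, K i))) :
    inner ℂ (ofWave b e x) (ofWave b e y) = inner ℂ x y := by
  rw [ofWave, ofWave, LinearIsometryEquiv.inner_map_map]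
  refine (hasSum_inner _ _).unique ?_
  refine ((configWord_injective e).hasSum_iff fun w hw => ?_).mpr (hasSum_inner x y)
  rw [hx w, map_zero, zero_mul]
  rintro h
  exact hw ((isSegment_iff_exists_configWord he).mp h)

/-- Every vector has a wave function. -/
lemma exists_wave (b : ∀ i, HilbertBasis (K i) ℂ (H i)) (ψ : HilbertTensor H) :
    ∃ x ∈ segmentSpace K 0 N, ‖x‖ = ‖ψ‖ ∧
      ∀ k : ∀ i, K i, inner ℂ (ket b k) ψ = x (configWord (fun i => i) k) := by
  classical
  let c := (productBasis b).repr ψ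
  have hinj : Function.Injective (configWord (fun i => i) : (∀ i, K i) → List (Σ i, K i)) :=
    configWord_injective fun i => i
  let f : List (Σ i, K i) → ℂ := Function.extend (configWord fun i => i) c 0
  have hf : ∀ k, f (configWord (fun i => i) k) = c k := fun k => hinj.extend_apply c 0 k
  have hf0 : ∀ w ∉ Set.range (configWord (fun i => i) : (∀ i, K i) → List (Σ i, K i)), f w = 0 :=
    fun w hw => Function.extend_apply' _ _ _ hw
  have hs : HasSum (fun w => ‖f w‖ ^ 2) (‖c‖ ^ 2) := by
    refine (hinj.hasSum_iff fun w hw => ?_).mp ((hasSum_norm_sq c).of_eqOn fun k => ?_)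
    · simp [hf0 w hw]
    · simp only [Function.comp_apply, hf]
  let x : SqSum (List (Σ i, K i)) := ⟨f, memℓp_two_iff.mpr hs.summable⟩
  refine ⟨x, fun w hw => hf0 w fun h => hw ?_, ?_, fun k => ?_⟩
  · exact (isSegment_iff_exists_configWord (e := fun i => i) (by simp)).mpr h
  · have h1 := (hasSum_norm_sq x).unique hs
    rw [(pow_left_inj₀ (norm_nonneg _) (norm_nonneg _) two_ne_zero).mp h1]
    exact LinearIsometryEquiv.norm_map _ _
  · have := (productBasis b).repr_apply_apply ψ k
    rw [productBasis_apply] at this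
    rw [ket, ← this]
    exact (hf k).symm

lemma hasSum_ket (b : ∀ i, HilbertBasis (K i) ℂ (H i)) (ψ : HilbertTensor H) :
    HasSum (fun k => inner ℂ (ket b k) ψ • ket b k) ψ := by
  refine ((productBasis b).hasSum_repr ψ).of_eqOn fun k => ?_
  rw [HilbertBasis.repr_apply_apply, productBasis_apply]
  rfl

lemma ext_inner_ket (b : ∀ i, HilbertBasis (K i) ℂ (H i)) {ψ ψ' : HilbertTensor H}
    (h : ∀ k, inner ℂ (ket b k) ψ = inner ℂ (ket b k) ψ') : ψ = ψ' := by
  have h1 := hasSum_ket b ψ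
  simp only [h] at h1
  exact h1.unique (hasSum_ket b ψ')

end WaveFunctions

/-! ## Full chains -/

section FullChains

variable {N : ℕ} {K : Fin N → Type*}

/-- The indicator functions of the configurations are orthonormal, and a nonempty segment has
infinitely many configurations. -/
lemma not_finiteDimensional_segmentSpace [∀ i, Infinite (K i)] {i m : ℕ} (hm : 0 < m)
    (him : i + m ≤ N) : ¬ FiniteDimensional ℂ (segmentSpace K i m) := by
  intro hfin
  let e : Fin m → Fin N := fun j => ⟨i + j, by omega⟩
  have hmem : ∀ k : ∀ j, K (e j), delta (configWord e k) ∈ segmentSpace K i m := fun k =>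
    delta_mem_vanishingOff ((isSegment_iff_exists_configWord (e := e) (by simp [e])).mpr ⟨k, rfl⟩)
  let v : (∀ j, K (e j)) → segmentSpace K i m := fun k => ⟨delta (configWord e k), hmem k⟩
  have hv : Orthonormal ℂ v := by
    rw [← LinearIsometry.orthonormal_comp_iff (segmentSpace K i m).subtypeₗᵢ]
    exact orthonormal_delta.comp _ (configWord_injective e)
  have : Nonempty (Fin m) := ⟨⟨0, hm⟩⟩
  have h1 : Infinite (∀ j, K (e j)) := Pi.infinite_of_right
  exact h1.not_finite hv.linearIndependent.finite

variable [∀ i, Countable (K i)]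

lemma exists_segmentSpace_basis (K : Fin N → Type*) [∀ i, Countable (K i)] (i m : ℕ) :
    ∃ (D : ℕ∞) (φ : ℕ → SqSum (List (Σ i, K i))), IsPartialOrthonormal D φ ∧
      (∀ a, φ a ∈ segmentSpace K i m) ∧ segmentSpace K i m ≤ closedSpan φ ∧
      (¬ FiniteDimensional ℂ (segmentSpace K i m) → D = ⊤) :=
  Submodule.exists_isPartialOrthonormal delta eq_zero_of_inner_delta _ (isClosed_vanishingOff _)

lemma norm_delta {X : Type*} (i : X) : ‖(delta i : SqSum X)‖ = 1 := orthonormal_delta.1 i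

lemma mem_closedSpan_constSeq {E : Type*} [NormedAddCommGroup E] [InnerProductSpace ℂ E] (x : E) :
    x ∈ closedSpan (constSeq x) := mem_closedSpan (constSeq x) 0

lemma segmentSpace_zero_le {K : Fin N → Type*} (i : ℕ) :
    segmentSpace K i 0 ≤ closedSpan (constSeq (delta [])) := fun x hx => by
  rw [eq_smul_delta_of_mem_segmentSpace hx]
  exact Submodule.smul_mem _ _ (mem_closedSpan_constSeq _)

lemma constSeq_mem {E : Type*} [AddCommGroup E] [Module ℂ E] {U : Submodule ℂ E} {x : E}
    (hx : x ∈ U) (a : ℕ) : constSeq x a ∈ U := by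
  unfold constSeq
  split_ifs
  · exact hx
  · exact U.zero_mem

lemma constSeq_eq_zero {E : Type*} [Zero E] (x : E) {a : ℕ} (ha : ¬ (a : ℕ∞) < 1) :
    constSeq x a = 0 := if_neg (by simpa using ha)

lemma delta_nil_mem_segmentSpace {K : Fin N → Type*} (i : ℕ) :
    delta [] ∈ segmentSpace K i 0 := delta_mem_vanishingOff (isSegment_zero.mpr rfl)

/-- A left chain of orthonormal bases with prescribed last family. -/
lemma exists_isLeftChain {n : ℕ} (hn : 0 < n) (hnN : n ≤ N) (Dn : ℕ∞)
    (ξ : ℕ → SqSum (List (Σ i, K i))) (hξ : ∀ a, ξ a ∈ segmentSpace K 0 n)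
    (hξ0 : ∀ a : ℕ, ¬ (a : ℕ∞) < Dn → ξ a = 0) :
    ∃ (D : ℕ → ℕ∞) (φ : ℕ → ℕ → SqSum (List (Σ i, K i))), IsLeftChain K n D φ ∧
      φ n = ξ ∧ D n = Dn ∧ ((∀ i, Infinite (K i)) → ∀ j, 0 < j → j < n → D j = ⊤) := by
  choose D₀ φ₀ h₁ h₂ h₃ h₄ using fun j => exists_segmentSpace_basis K 0 j
  -- At the inner bonds the family is a basis of the whole segment space, so the nesting condition
  -- reduces to the fact that a slice of a segment wave function is one on the shorter segment.
  let D : ℕ → ℕ∞ := fun j => if j = 0 then 1 else if j = n then Dn else D₀ j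
  let φ : ℕ → ℕ → SqSum (List (Σ i, K i)) := fun j =>
    if j = 0 then constSeq (delta []) else if j = n then ξ else φ₀ j
  have hmem : ∀ j a, φ j a ∈ segmentSpace K 0 j := by
    intro j a
    simp only [φ]
    split_ifs with h0 hj
    · subst h0
      exact constSeq_mem (delta_nil_mem_segmentSpace 0) a
    · subst hj; exact hξ a
    · exact h₂ j a
  refine ⟨D, φ, ⟨by simp [D], by simp [φ], fun j _ a ha => ?_, fun j hj => ?_,
    fun j _ a => hmem j a, fun j hj s a => ?_⟩, by simp [φ, hn.ne'], by simp [D, hn.ne'],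
    fun hinf j h0 hj => ?_⟩
  · simp only [D, φ] at ha ⊢
    split_ifs at ha ⊢ with h0 hjn
    · exact constSeq_eq_zero _ ha
    · exact hξ0 a ha
    · exact (h₁ j).eq_zero ha
  · simp only [D, φ, hj.ne, if_false]
    split_ifs with h0
    · exact isPartialOrthonormal_constSeq (norm_delta _)
    · exact h₁ j
  · have h5 := sliceR_mem_segmentSpace (w := [s]) (m := j) (hmem (j + 1) a) rfl
    generalize sliceR [s] (φ (j + 1) a) = y at h5
    simp only [φ, hj.ne, if_false]
    split_ifs with h0
    · subst h0
      exact segmentSpace_zero_le 0 h5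
    · exact h₃ j h5
  · simp only [D, hj.ne, h0.ne', if_false]
    exact h₄ j (not_finiteDimensional_segmentSpace h0 (by omega))

/-- A right chain of orthonormal bases with prescribed first family. -/
lemma exists_isRightChain {n : ℕ} (hnN : n < N) (Dn : ℕ∞)
    (ξ : ℕ → SqSum (List (Σ i, K i))) (hξ : ∀ a, ξ a ∈ segmentSpace K n (N - n))
    (hξ0 : ∀ a : ℕ, ¬ (a : ℕ∞) < Dn → ξ a = 0) :
    ∃ (D : ℕ → ℕ∞) (χ : ℕ → ℕ → SqSum (List (Σ i, K i))), IsRightChain K n D χ ∧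
      χ n = ξ ∧ D n = Dn ∧ ((∀ i, Infinite (K i)) → ∀ j, n < j → j < N → D j = ⊤) := by
  choose D₀ χ₀ h₁ h₂ h₃ h₄ using fun j => exists_segmentSpace_basis K j (N - j)
  let D : ℕ → ℕ∞ := fun j => if j = N then 1 else if j = n then Dn else D₀ j
  let χ : ℕ → ℕ → SqSum (List (Σ i, K i)) := fun j =>
    if j = N then constSeq (delta []) else if j = n then ξ else χ₀ j
  have hmem : ∀ j a, χ j a ∈ segmentSpace K j (N - j) := by
    intro j a
    simp only [χ]
    split_ifs with h0 hj
    · subst h0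
      rw [Nat.sub_self]
      exact constSeq_mem (delta_nil_mem_segmentSpace j) a
    · subst hj; exact hξ a
    · exact h₂ j a
  refine ⟨D, χ, ⟨by simp [D], by simp [χ], fun j _ _ a ha => ?_, fun j hj _ => ?_,
    fun j _ _ a => hmem j a, fun j hj hjN s a => ?_⟩, by simp [χ, hnN.ne], by simp [D, hnN.ne],
    fun hinf j h0 hj => ?_⟩
  · simp only [D, χ] at ha ⊢
    split_ifs at ha ⊢ with h0 hjn
    · exact constSeq_eq_zero _ ha
    · exact hξ0 a ha
    · exact (h₁ j).eq_zero ha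
  · simp only [D, χ, hj.ne', if_false]
    split_ifs with h0
    · exact isPartialOrthonormal_constSeq (norm_delta _)
    · exact h₁ j
  · have h5 : sliceL [s] (χ j a) ∈ segmentSpace K (j + 1) (N - (j + 1)) :=
      sliceL_mem_segmentSpace (w := [s]) (hmem j a) (by simp; omega)
    -- The prescribed family `ξ` sits at the first bond only, so nesting never requires its span to
    -- be large.
    have h6 : j + 1 ≠ n := by omega
    generalize sliceL [s] (χ j a) = y at h5
    simp only [χ, h6, if_false]
    split_ifs with h0
    · rw [h0, Nat.sub_self] at h5
      exact segmentSpace_zero_le N h5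
    · exact h₃ _ h5
  · simp only [D, hj.ne, h0.ne', if_false]
    exact h₄ j (not_finiteDimensional_segmentSpace (by omega) (by omega))

end FullChains

/-! ## Schmidt decompositions at all cuts -/

section Cuts

variable {N : ℕ} {K : Fin N → Type*}

/-- The columns of the matrix of `ψ` at the cut `n`. -/
def cutCol (ψ : SqSum (List (Σ i, K i))) (n : ℕ) (v : List (Σ i, K i)) :
    SqSum (List (Σ i, K i)) :=
  if v.length + n = N then sliceR v ψ else 0

/-- The rows of the matrix of `ψ` at the cut `n`. -/
def cutRow (ψ : SqSum (List (Σ i, K i))) (n : ℕ) (u : List (Σ i, K i)) :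
    SqSum (List (Σ i, K i)) :=
  if u.length = n then sliceL u ψ else 0

variable {ψ : SqSum (List (Σ i, K i))}

/-- If only one of the two length conditions holds, `u ++ v` does not have length `N`, so `ψ`
vanishes on it. -/
lemma cutCol_apply_eq_cutRow_apply (hψ : ψ ∈ segmentSpace K 0 N) (n : ℕ)
    (u v : List (Σ i, K i)) : cutCol ψ n v u = cutRow ψ n u v := by
  have h0 : (u ++ v).length ≠ N → ψ (u ++ v) = 0 := fun h => hψ _ fun h' => h h'.length_eq
  rw [List.length_append] at h0
  unfold cutCol cutRow
  split_ifs with h1 h2 h2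
  · rfl
  · exact h0 (by omega)
  · exact (h0 (by omega)).symm
  · rfl

/-- Contracting one more site moves a column to the neighbouring cut. This makes the left Schmidt
spaces of adjacent cuts nested. -/
lemma sliceR_cutCol (n : ℕ) (s : Σ i, K i) (v : List (Σ i, K i)) :
    sliceR [s] (cutCol ψ (n + 1) v) = cutCol ψ n (s :: v) := by
  have : v.length + (n + 1) = N ↔ (s :: v).length + n = N := by
    rw [List.length_cons]; omega
  unfold cutCol
  rw [apply_ite (sliceR [s]), map_zero, sliceR_sliceR]
  exact if_congr this rfl rfl

lemma sliceL_cutRow (n : ℕ) (s : Σ i, K i) (u : List (Σ i, K i)) :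
    sliceL [s] (cutRow ψ n u) = cutRow ψ (n + 1) (u ++ [s]) := by
  have : u.length = n ↔ (u ++ [s]).length = n + 1 := by simp
  unfold cutRow
  rw [apply_ite (sliceL [s]), map_zero, sliceL_sliceL]
  exact if_congr this rfl rfl

lemma cutCol_mem (hψ : ψ ∈ segmentSpace K 0 N) (n : ℕ) (v : List (Σ i, K i)) :
    cutCol ψ n v ∈ segmentSpace K 0 n := by
  unfold cutCol
  split_ifs with h
  · exact sliceR_mem_segmentSpace hψ (by omega)
  · exact Submodule.zero_mem _

lemma cutRow_mem (hψ : ψ ∈ segmentSpace K 0 N) {n : ℕ} (hn : n ≤ N) (u : List (Σ i, K i)) :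
    cutRow ψ n u ∈ segmentSpace K n (N - n) := by
  unfold cutRow
  split_ifs with h
  · have := sliceL_mem_segmentSpace (w := u) (m := N - n) hψ (by omega)
    rwa [zero_add, h] at this
  · exact Submodule.zero_mem _

lemma summable_ite_zero {ι : Type*} {p : ι → Prop} [DecidablePred p] {E : Type*}
    [NormedAddCommGroup E] {f : ι → E} (h : Summable fun i : {i // p i} => ‖f i‖ ^ 2) :
    Summable fun i => ‖if p i then f i else 0‖ ^ 2 := by
  refine (Function.Injective.summable_iff Subtype.val_injective fun i hi => ?_).mp
    (h.congr fun i => ?_)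
  · have hp : ¬ p i := by simpa using hi
    simp [hp]
  · have : p i := i.2
    simp [this]

/-- Once the length of `v` is fixed, concatenation is injective, so the squared entries form a
subfamily of those summing to `‖ψ‖ ^ 2`. -/
lemma summable_cutCol (n : ℕ) : Summable fun v => ‖cutCol ψ n v‖ ^ 2 := by
  refine summable_ite_zero ?_
  have hinj : Function.Injective fun p : {v : List (Σ i, K i) // v.length + n = N} × _ =>
      p.2 ++ p.1.1 := by
    rintro ⟨⟨v, hv⟩, u⟩ ⟨⟨v', hv'⟩, u'⟩ h
    obtain ⟨rfl, rfl⟩ := List.append_inj' h (by dsimp only; omega)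
    rfl
  exact summable_norm_sq_of_prod _ ((hasSum_norm_sq ψ).summable.comp_injective hinj)

lemma summable_cutRow (n : ℕ) : Summable fun u => ‖cutRow ψ n u‖ ^ 2 := by
  refine summable_ite_zero ?_
  have hinj : Function.Injective fun p : {v : List (Σ i, K i) // v.length = n} × _ =>
      p.1.1 ++ p.2 := by
    rintro ⟨⟨v, hv⟩, u⟩ ⟨⟨v', hv'⟩, u'⟩ h
    obtain ⟨rfl, rfl⟩ := List.append_inj h (by dsimp only; omega)
    rfl
  exact summable_norm_sq_of_prod _ ((hasSum_norm_sq ψ).summable.comp_injective hinj)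

/-- Schmidt data of `ψ` at the cut `n`, normalized at the outer cuts so that the trivial factor is
the unit vector and the weight is one. -/
structure IsCut (ψ : SqSum (List (Σ i, K i))) (n : ℕ) (D : ℕ∞) (σ : ℕ → ℝ)
    (φ χ : ℕ → SqSum (List (Σ i, K i))) : Prop where
  pos : ∀ a, 0 < σ a
  zero_left : ∀ a : ℕ, ¬ (a : ℕ∞) < D → φ a = 0
  zero_right : ∀ a : ℕ, ¬ (a : ℕ∞) < D → χ a = 0
  orthonormal_left : n < N → IsPartialOrthonormal D φ
  col_mem : n < N → ∀ v, cutCol ψ n v ∈ closedSpan φ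
  hasSum_row : n < N → ∀ a, HasSum (fun u => conj (φ a u) • cutRow ψ n u) ((σ a : ℂ) • χ a)
  right_mem : n < N → ∀ a, χ a ∈ closedSpan (cutRow ψ n)
  orthonormal_right : 0 < n → IsPartialOrthonormal D χ
  row_mem : 0 < n → ∀ u, cutRow ψ n u ∈ closedSpan χ
  inner_row : 0 < n → ∀ a u, inner ℂ (χ a) (cutRow ψ n u) = σ a * φ a u
  left_mem : 0 < n → ∀ a, φ a ∈ closedSpan (cutCol ψ n)
  summable : 0 < n → n < N → Summable fun a : {a : ℕ // (a : ℕ∞) < D} => σ a ^ 2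
  start : n = 0 → D = 1 ∧ σ = 1 ∧ φ = constSeq (delta []) ∧ χ = constSeq ψ
  final : n = N → D = 1 ∧ σ = 1 ∧ φ = constSeq ψ ∧ χ = constSeq (delta [])

lemma cutRow_zero_nil : cutRow ψ 0 [] = ψ := by
  ext v
  simp [cutRow]

lemma cutCol_last_nil : cutCol ψ N [] = ψ := by
  ext v
  simp [cutCol]

/-- At an outer cut `ψ` itself is the nontrivial factor, with weight one. It need be neither
normalized nor nonzero, which is why orthonormality on that side is demanded only away from this
cut. -/
lemma isCut_zero (hN : 0 < N) (hψ : ψ ∈ segmentSpace K 0 N) :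
    IsCut ψ 0 1 1 (constSeq (delta [])) (constSeq ψ) where
  pos _ := one_pos
  zero_left _ := constSeq_eq_zero _
  zero_right _ := constSeq_eq_zero _
  orthonormal_left _ := isPartialOrthonormal_constSeq (norm_delta _)
  col_mem _ v := segmentSpace_zero_le 0 (cutCol_mem hψ 0 v)
  hasSum_row _ a := by
    rw [Pi.one_apply, Complex.ofReal_one, one_smul]
    by_cases ha : a = 0
    · have h := hasSum_single (f := fun u => conj ((constSeq (delta []) a : SqSum _) u) •
        cutRow ψ 0 u) [] fun u hu => by
          simp [constSeq, ha, delta_apply_ne hu]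
      simpa [constSeq, ha, delta_apply_self, cutRow_zero_nil] using h
    · simp only [constSeq, ha, if_false]
      exact hasSum_zero.of_eqOn fun u => by simp
  right_mem _ := constSeq_mem (by
    have := mem_closedSpan (cutRow ψ 0) []
    rwa [cutRow_zero_nil] at this)
  orthonormal_right h := (lt_irrefl _ h).elim
  row_mem h := (lt_irrefl _ h).elim
  inner_row h := (lt_irrefl _ h).elim
  left_mem h := (lt_irrefl _ h).elim
  summable h := (lt_irrefl _ h).elim
  start _ := ⟨rfl, rfl, rfl, rfl⟩
  final h := (hN.ne h).elim

lemma isCut_last (hN : 0 < N) (hψ : ψ ∈ segmentSpace K 0 N) :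
    IsCut ψ N 1 1 (constSeq ψ) (constSeq (delta [])) where
  pos _ := one_pos
  zero_left _ := constSeq_eq_zero _
  zero_right _ := constSeq_eq_zero _
  orthonormal_left h := (lt_irrefl _ h).elim
  col_mem h := (lt_irrefl _ h).elim
  hasSum_row h := (lt_irrefl _ h).elim
  right_mem h := (lt_irrefl _ h).elim
  orthonormal_right _ := isPartialOrthonormal_constSeq (norm_delta _)
  row_mem _ u := segmentSpace_zero_le N (by simpa using cutRow_mem hψ le_rfl u)
  inner_row _ a u := by
    by_cases ha : a = 0
    · simp only [constSeq, ha, if_true, inner_delta, Pi.one_apply, Complex.ofReal_one, one_mul,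
        ← cutCol_apply_eq_cutRow_apply hψ N u [], cutCol_last_nil]
    · simp [constSeq, ha]
  left_mem _ := constSeq_mem (by
    have := mem_closedSpan (cutCol ψ N) []
    rwa [cutCol_last_nil] at this)
  summable _ h := (lt_irrefl _ h).elim
  start h := (hN.ne' h).elim
  final _ := ⟨rfl, rfl, rfl, rfl⟩

lemma exists_isCut (hN : 0 < N) (hψ : ψ ∈ segmentSpace K 0 N) {n : ℕ} (hn : n ≤ N) :
    ∃ D σ φ χ, IsCut ψ n D σ φ χ := by
  by_cases h0 : n = 0
  · subst h0
    exact ⟨_, _, _, _, isCut_zero hN hψ⟩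
  by_cases h1 : n = N
  · subst h1
    exact ⟨_, _, _, _, isCut_last hN hψ⟩
  obtain ⟨D, σ, φ, χ, hφ, hχ, hσ, hs, hA, hB, hC, hR⟩ :=
    exists_schmidt (cutCol ψ n) (cutRow ψ n) (cutCol_apply_eq_cutRow_apply hψ n)
      (summable_cutCol n) (summable_cutRow n)
  have hσ' : ∀ a, (σ a : ℂ) ≠ 0 := fun a => Complex.ofReal_ne_zero.mpr (hσ a).ne'
  refine ⟨D, σ, φ, χ, hσ, fun a => hφ.eq_zero, fun a => hχ.eq_zero, fun _ => hφ, fun _ => hC,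
    fun _ => hB, fun _ a => ?_, fun _ => hχ, fun _ => hR, fun _ a u => ?_, fun _ a => ?_,
    fun _ _ => hs, fun h => (h0 h).elim, fun h => (h1 h).elim⟩
  -- The vector `σ a • χ a` is a limit of combinations of rows, and the weight is nonzero.
  · have := (hB a).mem_of_isClosed (Submodule.isClosed_topologicalClosure _) fun u =>
      Submodule.smul_mem _ _ (mem_closedSpan (cutRow ψ n) u)
    exact (Submodule.smul_mem_iff _ (hσ' a)).mp this
  · refine (hasSum_inner _ _).unique ?_
    refine (hasSum_apply (hA a) u).of_eqOn fun v => ?_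
    rw [← cutCol_apply_eq_cutRow_apply hψ n]
    rfl
  · have := (hA a).mem_of_isClosed (Submodule.isClosed_topologicalClosure _) fun v =>
      Submodule.smul_mem _ _ (mem_closedSpan (cutCol ψ n) v)
    exact (Submodule.smul_mem_iff _ (hσ' a)).mp this

namespace IsCut

variable {n : ℕ} {D : ℕ∞} {σ : ℕ → ℝ} {φ χ : ℕ → SqSum (List (Σ i, K i))}

lemma inner_col (h : IsCut ψ n D σ φ χ) (hψ : ψ ∈ segmentSpace K 0 N) (hn : n < N) (a : ℕ)
    (v : List (Σ i, K i)) : inner ℂ (φ a) (cutCol ψ n v) = σ a * χ a v := by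
  refine (hasSum_inner _ _).unique ((hasSum_apply (h.hasSum_row hn a) v).of_eqOn fun u => ?_)
  rw [cutCol_apply_eq_cutRow_apply hψ n]
  rfl

lemma mem_left (h : IsCut ψ n D σ φ χ) (hψ : ψ ∈ segmentSpace K 0 N) (a : ℕ) :
    φ a ∈ segmentSpace K 0 n := by
  by_cases h0 : n = 0
  · subst h0
    rw [(h.start rfl).2.2.1]
    exact constSeq_mem (delta_nil_mem_segmentSpace 0) a
  · exact closedSpan_le (isClosed_vanishingOff _) (cutCol_mem hψ n) (h.left_mem (by omega) a)

lemma mem_right (h : IsCut ψ n D σ φ χ) (hψ : ψ ∈ segmentSpace K 0 N) (hn : n ≤ N) (a : ℕ) :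
    χ a ∈ segmentSpace K n (N - n) := by
  by_cases h0 : n = N
  · subst h0
    rw [(h.final rfl).2.2.2, Nat.sub_self]
    exact constSeq_mem (delta_nil_mem_segmentSpace n) a
  · exact closedSpan_le (isClosed_vanishingOff _) (cutRow_mem hψ hn) (h.right_mem (by omega) a)

/-- The two expressions for the matrix elements between the Schmidt vectors of adjacent cuts. -/
lemma mul_inner_slice (h : IsCut ψ n D σ φ χ) {D' : ℕ∞} {σ' : ℕ → ℝ}
    {φ' χ' : ℕ → SqSum (List (Σ i, K i))} (h' : IsCut ψ (n + 1) D' σ' φ' χ') (hn : n < N)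
    (s : Σ i, K i) (a c : ℕ) :
    σ a * inner ℂ (χ' c) (sliceL [s] (χ a)) = σ' c * inner ℂ (φ a) (sliceR [s] (φ' c)) := by
  -- Both sides are `∑ u, conj (φ a u) * ⟪χ' c, cutRow ψ (n + 1) (u ++ [s])⟫`: on the left `σ a • χ
  -- a` is expanded in rows, on the right the overlap with a row is `σ' c * φ' c (u ++ [s])`.
  have h1 := ((h.hasSum_row hn a).mapL (sliceL [s])).mapL (innerSL ℂ (χ' c))
  simp only [map_smul, innerSL_apply_apply, sliceL_cutRow, h'.inner_row n.succ_pos,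
    smul_eq_mul] at h1
  refine h1.unique (((hasSum_inner (φ a) (sliceR [s] (φ' c))).mul_left (σ' c : ℂ)).of_eqOn
    fun u => ?_)
  rw [sliceR_apply]
  ring

end IsCut

variable {D : ℕ → ℕ∞} {σ : ℕ → ℕ → ℝ} {φ χ : ℕ → ℕ → SqSum (List (Σ i, K i))}

/-- For nesting: a left Schmidt vector at cut `j + 1` is a limit of combinations of columns, whose
slices are columns at cut `j` and so lie in the closed span of `φ j`. -/
lemma isLeftChain_of_isCut (hN : 0 < N) (hψ : ψ ∈ segmentSpace K 0 N)
    (h : ∀ n ≤ N, IsCut ψ n (D n) (σ n) (φ n) (χ n)) : IsLeftChain K N D φ where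
  start_dim := ((h 0 hN.le).start rfl).1
  start := ((h 0 hN.le).start rfl).2.2.1
  zero j hj := (h j hj).zero_left
  orthonormal j hj := (h j hj.le).orthonormal_left hj
  mem j hj := (h j hj).mem_left hψ
  nested j hj s a := by
    refine map_mem_of_mem_closedSpan (sliceR [s]) (Submodule.isClosed_topologicalClosure _)
      (fun v => ?_) ((h (j + 1) hj).left_mem j.succ_pos a)
    rw [sliceR_cutCol]
    exact (h j hj.le).col_mem hj _

lemma isRightChain_of_isCut (hψ : ψ ∈ segmentSpace K 0 N)
    (h : ∀ n ≤ N, IsCut ψ n (D n) (σ n) (φ n) (χ n)) : IsRightChain K 0 D χ where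
  final_dim := ((h N le_rfl).final rfl).1
  final := ((h N le_rfl).final rfl).2.2.2
  zero j _ hj := (h j hj).zero_right
  orthonormal j h0 hj := (h j hj).orthonormal_right h0
  mem j _ hj := (h j hj).mem_right hψ hj
  nested j _ hj s a := by
    refine map_mem_of_mem_closedSpan (sliceL [s]) (Submodule.isClosed_topologicalClosure _)
      (fun u => ?_) ((h j hj.le).right_mem hj a)
    rw [sliceL_cutRow]
    exact (h (j + 1) hj).row_mem j.succ_pos _

end Cuts

/-! ## The canonical forms -/

section CanonicalForms

lemma IsLeftChain.mono {N : ℕ} {K : Fin N → Type*} {n n' : ℕ} {D : ℕ → ℕ∞}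
    {φ : ℕ → ℕ → SqSum (List (Σ i, K i))} (h : IsLeftChain K n D φ) (hn : n' ≤ n) :
    IsLeftChain K n' D φ where
  start_dim := h.start_dim
  start := h.start
  zero j hj := h.zero j (hj.trans hn)
  orthonormal j hj := h.orthonormal j (hj.trans_le hn)
  mem j hj := h.mem j (hj.trans hn)
  nested j hj := h.nested j (hj.trans_le hn)

lemma IsRightChain.mono {N : ℕ} {K : Fin N → Type*} {n n' : ℕ} {D : ℕ → ℕ∞}
    {χ : ℕ → ℕ → SqSum (List (Σ i, K i))} (h : IsRightChain K n D χ) (hn : n ≤ n') :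
    IsRightChain K n' D χ where
  final_dim := h.final_dim
  final := h.final
  zero j hj := h.zero j (hn.trans hj)
  orthonormal j hj := h.orthonormal j (hn.trans_lt hj)
  mem j hj := h.mem j (hn.trans hj)
  nested j hj := h.nested j (hn.trans hj)

variable {N : ℕ} {K : Fin N → Type*} {D : ℕ → ℕ∞}

lemma leftMatrix_eq_zero {φ : ℕ → ℕ → SqSum (List (Σ i, K i))} {s : Σ i, K i} {a c : ℕ}
    (h : φ s.1 a = 0 ∨ φ (s.1 + 1) c = 0) : leftMatrix φ s a c = 0 := by
  rcases h with h | h <;> simp [leftMatrix, h]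

lemma rightMatrix_eq_zero {χ : ℕ → ℕ → SqSum (List (Σ i, K i))} {s : Σ i, K i} {a c : ℕ}
    (h : χ s.1 a = 0 ∨ χ (s.1 + 1) c = 0) : rightMatrix χ s a c = 0 := by
  rcases h with h | h <;> simp [rightMatrix, h]

lemma IsLeftChain.leftMatrix_support {n : ℕ} {φ : ℕ → ℕ → SqSum (List (Σ i, K i))}
    (h : IsLeftChain K n D φ) {s : Σ i, K i} (hs : (s.1 : ℕ) < n) {a c : ℕ}
    (ha : leftMatrix φ s a c ≠ 0) : (a : ℕ∞) < D s.1 ∧ (c : ℕ∞) < D (s.1 + 1) := by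
  by_contra hc
  refine ha (leftMatrix_eq_zero ?_)
  rw [not_and_or] at hc
  exact hc.imp (h.zero _ hs.le a) (h.zero _ hs c)

lemma IsRightChain.rightMatrix_support {n : ℕ} {χ : ℕ → ℕ → SqSum (List (Σ i, K i))}
    (h : IsRightChain K n D χ) {s : Σ i, K i} (hs : n ≤ (s.1 : ℕ)) {a c : ℕ}
    (ha : rightMatrix χ s a c ≠ 0) : (a : ℕ∞) < D s.1 ∧ (c : ℕ∞) < D (s.1 + 1) := by
  by_contra hc
  refine ha (rightMatrix_eq_zero ?_)
  rw [not_and_or] at hc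
  exact hc.imp (h.zero _ hs s.1.2.le a) (h.zero _ (by omega) s.1.2 c)

lemma exists_isMatrixProduct_apply {L L' : List BondMatrix} {P : BondMatrix}
    (h : IsMatrixProduct L P) (hL : L' = L) {a a' : ℕ} {z : ℂ} (hz : P a a' = z) :
    ∃ P, IsMatrixProduct L' P ∧ P a a' = z :=
  ⟨P, hL ▸ h, hz⟩

variable {H : Fin N → Type*}
  [∀ i, NormedAddCommGroup (H i)] [∀ i, InnerProductSpace ℂ (H i)]
  {b : ∀ i, HilbertBasis (K i) ℂ (H i)} {ψ : HilbertTensor H} {x : SqSum (List (Σ i, K i))}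

lemma isMatrixProductVector_of_wave
    (hx : ∀ k : ∀ i, K i, inner ℂ (ket b k) ψ = x (configWord (fun i => i) k))
    {M : ∀ i, K i → BondMatrix} {Λ : Fin N → ℕ → ℝ}
    (h : ∀ k : ∀ i, K i, ∃ P, IsMatrixProduct (mpsFactors (fun i => M i (k i)) Λ) P ∧
      P 0 0 = x (configWord (fun i => i) k)) : IsMatrixProductVector b M Λ 0 0 ψ := by
  refine ⟨_, h, ?_⟩
  simp only [← hx]
  exact hasSum_ket b ψ

/-- With `δ_[]` at bond `0` and the wave function at bond `N`, the collapsed product is evaluation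
at the configuration word; all weights are one. -/
lemma isMPS_of_isLeftChain (hN : 0 < N)
    (hx : ∀ k : ∀ i, K i, inner ℂ (ket b k) ψ = x (configWord (fun i => i) k))
    {φ : ℕ → ℕ → SqSum (List (Σ i, K i))} (h : IsLeftChain K N D φ) (hφ : φ N = constSeq x)
    (hD : D N = 1) : IsMPS b D (fun i k => leftMatrix φ ⟨i, k⟩) 1 ψ where
  left_dim := h.start_dim
  right_dim := hD
  support i k a c hac := h.leftMatrix_support (s := ⟨i, k⟩) i.2 hac
  expansion := by
    refine isMatrixProductVector_of_wave hx fun k => ?_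
    have h1 := h.isMatrixProduct hN (fun i => ⟨i, k i⟩) (fun i => rfl) (fun _ _ => 1)
      (fun _ _ => one_ne_zero)
    refine exists_isMatrixProduct_apply h1 ?_ ?_
    · simp [mpsFactors]
    · simp [h.start, hφ, constSeq, inner_delta, configWord]

lemma isMPS_of_isRightChain (hN : 0 < N)
    (hx : ∀ k : ∀ i, K i, inner ℂ (ket b k) ψ = x (configWord (fun i => i) k))
    {χ : ℕ → ℕ → SqSum (List (Σ i, K i))} (h : IsRightChain K 0 D χ) (hχ : χ 0 = constSeq x)
    (hD : D 0 = 1) : IsMPS b D (fun i k => rightMatrix χ ⟨i, k⟩) 1 ψ where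
  left_dim := hD
  right_dim := h.final_dim
  support i k a c hac := h.rightMatrix_support (s := ⟨i, k⟩) (Nat.zero_le _) hac
  expansion := by
    refine isMatrixProductVector_of_wave hx fun k => ?_
    have h1 := h.isMatrixProduct hN (zero_add N) (fun i => ⟨i, k i⟩) (fun i => by simp)
    refine exists_isMatrixProduct_apply h1 ?_ ?_
    · simp [mpsFactors]
    · simp [h.final, hχ, constSeq, inner_delta, configWord]

/-- Orthonormality at bond `i + 1` is a separate hypothesis because a chain does not provide it at
its last bond. -/
lemma IsLeftChain.leftNormalized {n : ℕ} {φ : ℕ → ℕ → SqSum (List (Σ i, K i))}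
    (h : IsLeftChain K n D φ) {i : Fin N} (hi : (i : ℕ) < n)
    (ho : IsPartialOrthonormal (D (i + 1)) (φ (i + 1))) :
    LeftNormalized D (fun i k => leftMatrix φ ⟨i, k⟩) i := by
  intro c c' hc _
  rw [← ho.inner_self hc]
  exact h.hasSum_leftMatrix hi c c'

lemma IsRightChain.rightNormalized {n : ℕ} {χ : ℕ → ℕ → SqSum (List (Σ i, K i))}
    (h : IsRightChain K n D χ) {i : Fin N} (hi : n ≤ (i : ℕ))
    (ho : IsPartialOrthonormal (D i) (χ i)) :
    RightNormalized D (fun i k => rightMatrix χ ⟨i, k⟩) i := by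
  intro c c' _ hc'
  have := h.hasSum_rightMatrix hi c c'
  rw [ho.inner_self hc'] at this
  simpa only [eq_comm] using this

/-- The left-canonical form. -/
theorem exists_leftCanonical [∀ i, Countable (K i)] (hN : 0 < N) (hxm : x ∈ segmentSpace K 0 N)
    (hxn : ‖x‖ = ‖ψ‖)
    (hx : ∀ k : ∀ i, K i, inner ℂ (ket b k) ψ = x (configWord (fun i => i) k)) :
    ∃ (D : ℕ → ℕ∞) (A : ∀ i, K i → BondMatrix),
      IsMPS b D A 1 ψ ∧
      (∀ i : Fin N, (i : ℕ) + 1 < N → LeftNormalized D A i) ∧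
      (‖ψ‖ = 1 → IsLeftCanonical b D A ψ) ∧
      ((∀ i, Infinite (K i)) → ∀ j, 0 < j → j < N → D j = ⊤) := by
  obtain ⟨D, φ, h, hφ, hD, hinf⟩ := exists_isLeftChain hN le_rfl 1 (constSeq x)
    (constSeq_mem hxm) fun a => constSeq_eq_zero x
  have hmps := isMPS_of_isLeftChain hN hx h hφ hD
  have hnorm : ∀ i : Fin N, (i : ℕ) + 1 < N →
      LeftNormalized D (fun i k => leftMatrix φ ⟨i, k⟩) i := fun i hi =>
    h.leftNormalized i.2 (h.orthonormal _ hi)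
  refine ⟨D, _, hmps, hnorm, fun h1 => ⟨hmps, fun i => ?_⟩, hinf⟩
  by_cases hi : (i : ℕ) + 1 < N
  · exact hnorm i hi
  -- The family at bond `N` consists of the wave function alone, which is orthonormal exactly when
  -- it is a unit vector.
  · refine h.leftNormalized i.2 ?_
    have hi' : (i : ℕ) + 1 = N := by omega
    rw [hi', hφ, hD]
    exact isPartialOrthonormal_constSeq (hxn.trans h1)

/-- The right-canonical form. -/
theorem exists_rightCanonical [∀ i, Countable (K i)] (hN : 0 < N) (hxm : x ∈ segmentSpace K 0 N)
    (hxn : ‖x‖ = ‖ψ‖)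
    (hx : ∀ k : ∀ i, K i, inner ℂ (ket b k) ψ = x (configWord (fun i => i) k)) :
    ∃ (D : ℕ → ℕ∞) (B : ∀ i, K i → BondMatrix),
      IsMPS b D B 1 ψ ∧
      (∀ i : Fin N, 0 < (i : ℕ) → RightNormalized D B i) ∧
      (‖ψ‖ = 1 → IsRightCanonical b D B ψ) ∧
      ((∀ i, Infinite (K i)) → ∀ j, 0 < j → j < N → D j = ⊤) := by
  obtain ⟨D, χ, h, hχ, hD, hinf⟩ := exists_isRightChain hN 1 (constSeq x)
    (constSeq_mem hxm) fun a => constSeq_eq_zero x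
  have hmps := isMPS_of_isRightChain hN hx h hχ hD
  have hnorm : ∀ i : Fin N, 0 < (i : ℕ) →
      RightNormalized D (fun i k => rightMatrix χ ⟨i, k⟩) i := fun i hi =>
    h.rightNormalized (Nat.zero_le _) (h.orthonormal _ hi i.2.le)
  refine ⟨D, _, hmps, hnorm, fun h1 => ⟨hmps, fun i => ?_⟩, hinf⟩
  by_cases hi : 0 < (i : ℕ)
  · exact hnorm i hi
  · refine h.rightNormalized (Nat.zero_le _) ?_
    have hi' : (i : ℕ) = 0 := by omega
    rw [hi', hχ, hD]
    exact isPartialOrthonormal_constSeq (hxn.trans h1)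

/-- Schmidt vectors at the cut `n`, extended to infinite sequences if all sites are
infinite-dimensional. -/
lemma exists_extended_cut (hxm : x ∈ segmentSpace K 0 N) {n : ℕ} (h0 : 0 < n) (hn : n < N) :
    ∃ (D : ℕ∞) (ξ η : ℕ → SqSum (List (Σ i, K i))) (d : ℕ → ℝ),
      IsPartialOrthonormal D ξ ∧ IsPartialOrthonormal D η ∧
      (∀ a, ξ a ∈ segmentSpace K 0 n) ∧ (∀ a, η a ∈ segmentSpace K n (N - n)) ∧
      (∀ a, 0 ≤ d a) ∧ (∀ v, cutCol x n v ∈ closedSpan ξ) ∧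
      (∀ a v, inner ℂ (ξ a) (cutCol x n v) = d a * η a v) ∧
      ((∀ i, Infinite (K i)) → D = ⊤) := by
  classical
  obtain ⟨D, σ, φ, χ, h⟩ := exists_isCut (h0.trans hn) hxm hn.le
  have hφ := h.orthonormal_left hn
  have hχ := h.orthonormal_right h0
  by_cases hinf : ∀ i, Infinite (K i)
  · obtain ⟨ξ, hξ, hξm, hξφ⟩ := hφ.exists_extension (segmentSpace K 0 n) (isClosed_vanishingOff _)
      (h.mem_left hxm) (not_finiteDimensional_segmentSpace h0 (by omega))
    obtain ⟨η, hη, hηm, hηχ⟩ := hχ.exists_extension (segmentSpace K n (N - n))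
      (isClosed_vanishingOff _) (h.mem_right hxm hn.le)
      (not_finiteDimensional_segmentSpace (by omega) (by omega))
    -- The added vectors get weight zero.
    refine ⟨⊤, ξ, η, fun a => if (a : ℕ∞) < D then σ a else 0, hξ, hη, hξm, hηm, fun a => ?_,
      fun v => ?_, fun a v => ?_, fun _ => rfl⟩
    · dsimp only
      split_ifs
      · exact (h.pos a).le
      · exact le_rfl
    · refine closedSpan_le (Submodule.isClosed_topologicalClosure _) (fun a => ?_) (h.col_mem hn v)
      by_cases ha : (a : ℕ∞) < D
      · rw [← hξφ a ha]
        exact mem_closedSpan ξ a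
      · rw [hφ.eq_zero ha]
        exact Submodule.zero_mem _
    · by_cases ha : (a : ℕ∞) < D
      · simp only [ha, if_true]
        rw [hξφ a ha, hηχ a ha]
        exact h.inner_col hxm hn a v
      · simp only [ha, if_false, Complex.ofReal_zero, zero_mul]
        -- An added vector `ξ a` is orthogonal to every `φ c`, hence to their closed span, which
        -- contains all columns.
        refine map_mem_of_mem_closedSpan (innerSL ℂ (ξ a)) (U := ⊥) (by simp) (fun c => ?_)
          (h.col_mem hn v)
        rw [Submodule.mem_bot, innerSL_apply_apply]
        by_cases hc : (c : ℕ∞) < D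
        · rw [← hξφ c hc, hξ a c, if_neg]
          rintro ⟨rfl, -⟩
          exact ha hc
        · rw [hφ.eq_zero hc, inner_zero_right]
  · exact ⟨D, φ, χ, σ, hφ, hχ, h.mem_left hxm, h.mem_right hxm hn.le, fun a => (h.pos a).le,
      h.col_mem hn, h.inner_col hxm hn, fun hi => (hinf hi).elim⟩

/-- The mixed-canonical form. -/
theorem exists_mixedCanonical [∀ i, Countable (K i)] (hxm : x ∈ segmentSpace K 0 N)
    (hx : ∀ k : ∀ i, K i, inner ℂ (ket b k) ψ = x (configWord (fun i => i) k))
    {n : ℕ} (h0 : 0 < n) (hn : n < N) :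
    ∃ (D : ℕ → ℕ∞) (M : ∀ i, K i → BondMatrix) (d : ℕ → ℝ),
      IsMixedCanonical b n D M d ψ ∧
      ((∀ i, Infinite (K i)) → ∀ j, 0 < j → j < N → D j = ⊤) := by
  obtain ⟨Dn, ξ, η, d, hξ, hη, hξm, hηm, hd, hcol, hinner, hinf⟩ := exists_extended_cut hxm h0 hn
  obtain ⟨D₁, φ, h₁, hφ, hD₁, hinf₁⟩ := exists_isLeftChain h0 hn.le Dn ξ hξm fun a => hξ.eq_zero
  obtain ⟨D₂, χ, h₂, hχ, hD₂, hinf₂⟩ := exists_isRightChain hn Dn η hηm fun a => hη.eq_zero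
  subst hφ hχ
  -- The two chains overlap in bond `n`, where both have dimension `Dn`.
  let D : ℕ → ℕ∞ := fun j => if j ≤ n then D₁ j else D₂ j
  have hDl : ∀ j ≤ n, D j = D₁ j := fun j hj => by simp [D, hj]
  have hDr : ∀ j, n ≤ j → D j = D₂ j := by
    intro j hj
    rcases hj.eq_or_lt with rfl | hj
    · rw [hDl n le_rfl, hD₁, hD₂]
    · simp [D, hj.not_ge]
  let M : ∀ i, K i → BondMatrix := fun i k =>
    if (i : ℕ) < n then leftMatrix φ ⟨i, k⟩ else rightMatrix χ ⟨i, k⟩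
  have hMl : ∀ i : Fin N, (i : ℕ) < n → M i = fun k => leftMatrix φ ⟨i, k⟩ := fun i hi => by
    simp [M, hi]
  have hMr : ∀ i : Fin N, n ≤ (i : ℕ) → M i = fun k => rightMatrix χ ⟨i, k⟩ := fun i hi => by
    simp [M, hi.not_gt]
  refine ⟨D, M, d, ⟨⟨?_, ?_, fun i k a c hac => ?_, ?_⟩, hd, fun i hi => ?_, fun i hi => ?_⟩,
    fun hi j hj hjN => ?_⟩
  · rw [hDl 0 h0.le, h₁.start_dim]
  · rw [hDr N hn.le, h₂.final_dim]
  · rcases lt_or_ge (i : ℕ) n with hi | hi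
    · rw [hMl i hi] at hac
      rw [hDl i hi.le, hDl (i + 1) hi]
      exact h₁.leftMatrix_support (s := ⟨i, k⟩) hi hac
    · rw [hMr i hi] at hac
      rw [hDr i hi, hDr (i + 1) (by omega)]
      exact h₂.rightMatrix_support (s := ⟨i, k⟩) hi hac
  · refine isMatrixProductVector_of_wave hx fun k => ?_
    have h1 := isMatrixProduct_mixed h₁ (hD₁ ▸ hξ) h₂ h0 hn (fun a => d a)
      (ψ := x) (fun v hv => by simpa [cutCol, hv] using hcol v)
      (fun a v hv => by simpa [cutCol, hv] using hinner a v) (fun i => ⟨i, k i⟩) (fun i => rfl)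
    refine exists_isMatrixProduct_apply h1 ?_ ?_
    · rw [mpsFactors]
      congr 1
      funext i a c
      have e1 : (M i (k i)) a c = if (i : ℕ) < n then leftMatrix φ ⟨i, k i⟩ a c
          else rightMatrix χ ⟨i, k i⟩ a c := by
        simp only [M]
        split_ifs <;> rfl
      rw [e1]
      congr 1
      by_cases hi : (i : ℕ) + 1 = n
      · simp [hi, hn]
      · simp [hi]
    · simp [h₁.start, constSeq, inner_delta, configWord]
  · intro c c' hc hc'
    rw [hDl _ (by omega)] at hc hc'
    rw [hMl i hi]
    refine h₁.leftNormalized hi ?_ c c' hc hc'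
    rcases Nat.lt_or_ge (i + 1) n with hin | hin
    · exact h₁.orthonormal _ hin
    · have : (i : ℕ) + 1 = n := by omega
      rw [this, hD₁]
      exact hξ
  · intro c c' hc hc'
    rw [hDr _ hi] at hc hc'
    rw [hMr i hi]
    refine h₂.rightNormalized hi ?_ c c' hc hc'
    rcases hi.eq_or_lt with hin | hin
    · rw [← hin, hD₂]
      exact hη
    · exact h₂.orthonormal _ hin i.2.le
  · rcases lt_trichotomy j n with h | h | h
    · rw [hDl j h.le]; exact hinf₁ hi j hj h
    · rw [h, hDl n le_rfl, hD₁]; exact hinf hi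
    · rw [hDr j h.le]; exact hinf₂ hi j h hjN

lemma val_leftSite {n : ℕ} (hn : n ≤ N) (i : Fin n) : (leftSite n hn i : ℕ) = i := by
  simp [leftSite, cutEquiv]

lemma val_rightSite {n : ℕ} (hn : n ≤ N) (j : Fin (N - n)) :
    (rightSite n hn j : ℕ) = n + j := by
  simp [rightSite, cutEquiv]

lemma configWord_append {n : ℕ} (hn : n ≤ N) (k : ∀ i, K i) :
    configWord (leftSite n hn) (fun i => k (leftSite n hn i)) ++
      configWord (rightSite n hn) (fun j => k (rightSite n hn j)) =
      configWord (fun i => i) k := by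
  have hs : ∀ i j : Fin N, i = j → (⟨i, k i⟩ : Σ i, K i) = ⟨j, k j⟩ := by rintro i _ rfl; rfl
  refine List.ext_getElem (by simp [configWord]; omega) fun i h1 h2 => ?_
  simp only [configWord, List.getElem_append, List.getElem_ofFn, List.length_ofFn]
  split_ifs with h
  · exact hs _ _ (Fin.ext (val_leftSite hn _))
  · refine hs _ _ (Fin.ext ((val_rightSite hn _).trans ?_))
    dsimp only
    omega

/-- The Schmidt decomposition at an inner cut. -/
lemma IsCut.isSchmidtDecomposition (hxm : x ∈ segmentSpace K 0 N)
    (hx : ∀ k : ∀ i, K i, inner ℂ (ket b k) ψ = x (configWord (fun i => i) k))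
    {n : ℕ} (h0 : 0 < n) (hn : n < N) {D : ℕ∞} {σ : ℕ → ℝ} {φ χ : ℕ → SqSum (List (Σ i, K i))}
    (h : IsCut x n D σ φ χ) :
    IsSchmidtDecomposition n hn.le D σ (fun a => ofWave b (leftSite n hn.le) (φ a))
      (fun a => ofWave b (rightSite n hn.le) (χ a)) ψ := by
  classical
  have hφ := h.orthonormal_left hn
  have hχ := h.orthonormal_right h0
  have hφi : ∀ a c, inner ℂ (ofWave b (leftSite n hn.le) (φ a)) (ofWave b (leftSite n hn.le) (φ c))
      = inner ℂ (φ a) (φ c) := fun a c =>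
    inner_ofWave b (fun i => by rw [val_leftSite, zero_add]) (h.mem_left hxm a) _
  have hχi : ∀ a c,
      inner ℂ (ofWave b (rightSite n hn.le) (χ a)) (ofWave b (rightSite n hn.le) (χ c))
      = inner ℂ (χ a) (χ c) := fun a c =>
    inner_ofWave b (val_rightSite hn.le) (h.mem_right hxm hn.le a) _
  -- Orthonormality of the products reduces convergence of the Schmidt series to summability of `σ a
  -- ^ 2`.
  have ho : Orthonormal ℂ fun a : {a : ℕ // (a : ℕ∞) < D} =>
      joinTensor H (cutEquiv n hn.le) (ofWave b (leftSite n hn.le) (φ a))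
        (ofWave b (rightSite n hn.le) (χ a)) := by
    rw [orthonormal_iff_ite]
    rintro ⟨a, ha⟩ ⟨c, hc⟩
    rw [inner_joinTensor, hφi, hχi, hφ.inner_self ha, hχ.inner_self ha]
    simp
  refine ⟨?_, ?_, fun a _ => (h.pos a).le, ?_, ?_⟩
  · rw [orthonormal_iff_ite]
    rintro ⟨a, ha⟩ ⟨c, hc⟩
    rw [hφi, hφ.inner_self ha]
    simp
  · rw [orthonormal_iff_ite]
    rintro ⟨a, ha⟩ ⟨c, hc⟩
    rw [hχi, hχ.inner_self ha]
    simp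
  · have h1 := (h.summable h0 hn).tendsto_cofinite_zero
    have h2 := (Real.continuous_sqrt.tendsto 0).comp h1
    rw [Real.sqrt_zero] at h2
    refine h2.congr fun a => ?_
    exact Real.sqrt_sq (h.pos a).le
  · have hs : Summable fun a : {a : ℕ // (a : ℕ∞) < D} => (σ a : ℂ) •
        joinTensor H (cutEquiv n hn.le) (ofWave b (leftSite n hn.le) (φ a))
          (ofWave b (rightSite n hn.le) (χ a)) := by
      have := (ho.orthogonalFamily.summable_iff_norm_sq_summable fun a => (σ a : ℂ)).mpr (by
        simpa using h.summable h0 hn)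
      simpa using this
    obtain ⟨ψ', hψ'⟩ := hs
    suffices hψ : ψ = ψ' by rwa [hψ]
    refine ext_inner_ket b fun k => ?_
    have h1 := hψ'.mapL (innerSL ℂ (ket b k))
    have hket : ket b k = joinTensor H (cutEquiv n hn.le)
        (ket (fun i => b (leftSite n hn.le i)) fun i => k (leftSite n hn.le i))
        (ket (fun j => b (rightSite n hn.le j)) fun j => k (rightSite n hn.le j)) :=
      (joinTensor_pureTensor (cutEquiv n hn.le) fun i => b i (k i)).symm
    rw [hx]
    refine HasSum.unique ?_ h1
    simp only [map_smul, innerSL_apply_apply, hket, inner_joinTensor, inner_ket_ofWave]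
    set u := configWord (leftSite n hn.le) fun i => k (leftSite n hn.le i) with hu
    set v := configWord (rightSite n hn.le) fun j => k (rightSite n hn.le j) with hv
    -- Parseval between `δ_u` and the column at `v` reads `∑ a, φ a u * (σ a * χ a v) = x (u ++ v)`,
    -- the coefficient of `ψ` on the configuration `k`.
    have h2 := hφ.hasSum_inner_mul_inner (delta u) (h.col_mem hn v)
    have hlen : v.length + n = N := by
      simp only [hv, configWord, List.length_ofFn]
      omega
    simp only [inner_delta, h.inner_col hxm hn] at h2
    rw [cutCol, if_pos hlen, sliceR_apply, hu, hv, configWord_append] at h2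
    refine ((hasSum_subtype_iff_of_support_subset (s := {a : ℕ | (a : ℕ∞) < D})
      fun a ha => ?_).mpr h2).of_eqOn fun a => ?_
    · by_contra hD
      exact ha (by simp [hφ.eq_zero hD])
    · simp only [Function.comp_apply, smul_eq_mul]
      ring

/-- The canonical form. -/
theorem exists_canonical (hN : 0 < N) (hxm : x ∈ segmentSpace K 0 N)
    (hx : ∀ k : ∀ i, K i, inner ℂ (ket b k) ψ = x (configWord (fun i => i) k)) :
    ∃ (D : ℕ → ℕ∞) (Γ : ∀ i, K i → BondMatrix) (Λ : ℕ → ℕ → ℝ), IsCanonical b D Γ Λ ψ := by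
  have hex : ∀ n, ∃ D σ φ χ, n ≤ N → IsCut x n D σ φ χ := by
    intro n
    by_cases hn : n ≤ N
    · obtain ⟨D, σ, φ, χ, h⟩ := exists_isCut hN hxm hn
      exact ⟨D, σ, φ, χ, fun _ => h⟩
    · exact ⟨0, 1, 0, 0, fun h => (hn h).elim⟩
  choose D σ₀ φ χ h₀ using hex
  -- Nothing is known about the chosen data past bond `N`; the value one makes the weights
  -- invertible on every bond.
  let σ : ℕ → ℕ → ℝ := fun n => if n ≤ N then σ₀ n else 1
  have h : ∀ n ≤ N, IsCut x n (D n) (σ n) (φ n) (χ n) := fun n hn => by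
    simpa [σ, hn] using h₀ n hn
  have hσ : ∀ n a, (σ n a : ℂ) ≠ 0 := by
    intro n a
    refine Complex.ofReal_ne_zero.mpr (ne_of_gt ?_)
    by_cases hn : n ≤ N
    · exact (h n hn).pos a
    · simp [σ, hn]
  have hl := isLeftChain_of_isCut hN hxm h
  have hr := isRightChain_of_isCut hxm h
  have hσ0 : σ 0 = 1 := ((h 0 hN.le).start rfl).2.1
  have hσN : σ N = 1 := ((h N le_rfl).final rfl).2.1
  -- The weight of the left bond is divided out of the left matrix, so that `Λ Γ` is the left matrix
  -- and, by `hΓ`, `Γ Λ` is the right matrix.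
  let Γ : ∀ i, K i → BondMatrix := fun i k a c => (σ i a : ℂ)⁻¹ * leftMatrix φ ⟨i, k⟩ a c
  -- Here `l` is the position of site `i` in a product of `m` factors. The last factor carries no
  -- weight, which is harmless if it sits at the last site, because `σ N = 1`.
  have hΓ : ∀ (i : Fin N) (k : K i) (m : ℕ) (l : Fin m), ((l : ℕ) + 1 = m → (i : ℕ) + 1 = N) →
      (fun a c => Γ i k a c * (if (l : ℕ) + 1 < m then (σ (i + 1) c : ℂ) else 1))
        = rightMatrix χ ⟨i, k⟩ := by
    intro i k m l hil
    ext a c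
    have h1 := (h i i.2.le).mul_inner_slice (h (i + 1) i.2) i.2 ⟨i, k⟩ a c
    have h2 : (if (l : ℕ) + 1 < m then (σ (i + 1) c : ℂ) else 1) = σ (i + 1) c := by
      split_ifs with hlm
      · rfl
      · rw [hil (by omega), hσN]
        simp
    rw [h2]
    simp only [Γ, leftMatrix, rightMatrix]
    rw [mul_assoc, mul_comm _ (σ (i + 1) c : ℂ), ← h1, inv_mul_cancel_left₀ (hσ _ _)]
  refine ⟨D, Γ, σ, ⟨hl.start_dim, hr.final_dim, fun i k a c hac => ?_, ?_⟩, fun n h0 hn =>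
    ⟨_, _, fun a _ => ⟨_, fun k => ?_, hasSum_ofWave b _ (φ n a)⟩,
      fun a _ => ⟨_, fun k => ?_, hasSum_ofWave b _ (χ n a)⟩,
      (h n hn.le).isSchmidtDecomposition hxm hx h0 hn⟩⟩
  · exact hl.leftMatrix_support (s := ⟨i, k⟩) i.2 (right_ne_zero_of_mul hac)
  · refine isMatrixProductVector_of_wave hx fun k => ?_
    have h1 := hr.isMatrixProduct hN (zero_add N) (fun i => ⟨i, k i⟩) (fun i => by simp)
    refine exists_isMatrixProduct_apply h1 ?_ ?_
    · rw [mpsFactors]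
      congr 1
      funext i
      exact hΓ i (k i) N i id
    · simp [hr.final, ((h 0 hN.le).start rfl).2.2.2, constSeq, inner_delta, configWord]
  -- For the left part the weights telescope against the inverses in `Γ`, and the remaining weight
  -- at bond `0` is one.
  · have h1 := (hl.mono hn.le).isMatrixProduct h0
      (fun i => ⟨leftSite n hn.le i, k i⟩) (fun i => val_leftSite hn.le i) (fun j a => σ j a) hσ
    refine exists_isMatrixProduct_apply h1 ?_ ?_
    · simp only [Γ, mpsFactors, val_leftSite]
    · simp [hl.start, hσ0, constSeq, inner_delta, configWord]
  · have h1 := (hr.mono (Nat.zero_le n)).isMatrixProduct (m := N - n) (by omega) (by omega)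
      (fun i => ⟨rightSite n hn.le i, k i⟩) (fun i => val_rightSite hn.le i)
    refine exists_isMatrixProduct_apply h1 ?_ ?_
    · rw [mpsFactors]
      congr 1
      funext i
      exact hΓ (rightSite n hn.le i) (k i) (N - n) i fun hi => by rw [val_rightSite]; omega
    · simp [hr.final, constSeq, inner_delta, configWord]

end CanonicalForms

lemma HilbertBasis.infinite_of_not_finiteDimensional {ι E : Type*} [NormedAddCommGroup E]
    [InnerProductSpace ℂ E] (b : HilbertBasis ι ℂ E) (h : ¬ FiniteDimensional ℂ E) :
    Infinite ι := by
  by_contra hfin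
  rw [not_infinite_iff_finite] at hfin
  have := Fintype.ofFinite ι
  exact h b.toOrthonormalBasis.toBasis.finiteDimensional_of_finite

end

theorem mainTheorem1 {N : ℕ} (hN : 0 < N) {H : Fin N → Type*}
    [∀ i, NormedAddCommGroup (H i)] [∀ i, InnerProductSpace ℂ (H i)]
    [∀ i, CompleteSpace (H i)] [∀ i, TopologicalSpace.SeparableSpace (H i)]
    {K : Fin N → Type*} (b : ∀ i, HilbertBasis (K i) ℂ (H i)) (ψ : HilbertTensor H) :
    -- left-canonical form
    (∃ (D : ℕ → ℕ∞) (A : ∀ i, K i → BondMatrix),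
      IsMPS b D A 1 ψ ∧
      (∀ i : Fin N, (i : ℕ) + 1 < N → LeftNormalized D A i) ∧
      (‖ψ‖ = 1 → IsLeftCanonical b D A ψ) ∧
      ((∀ i, ¬ FiniteDimensional ℂ (H i)) → ∀ j, 0 < j → j < N → D j = ⊤)) ∧
    -- right-canonical form
    (∃ (D : ℕ → ℕ∞) (B : ∀ i, K i → BondMatrix),
      IsMPS b D B 1 ψ ∧
      (∀ i : Fin N, 0 < (i : ℕ) → RightNormalized D B i) ∧
      (‖ψ‖ = 1 → IsRightCanonical b D B ψ) ∧
      ((∀ i, ¬ FiniteDimensional ℂ (H i)) → ∀ j, 0 < j → j < N → D j = ⊤)) ∧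
    -- mixed-canonical form, for every cut
    (∀ n : ℕ, 0 < n → n < N → ∃ (D : ℕ → ℕ∞) (M : ∀ i, K i → BondMatrix) (d : ℕ → ℝ),
      IsMixedCanonical b n D M d ψ ∧
      ((∀ i, ¬ FiniteDimensional ℂ (H i)) → ∀ j, 0 < j → j < N → D j = ⊤)) ∧
    -- canonical form
    (∃ (D : ℕ → ℕ∞) (Γ : ∀ i, K i → BondMatrix) (Λ : ℕ → ℕ → ℝ), IsCanonical b D Γ Λ ψ) := by

  -- Countable bases are what allows the bond bases of the segment spaces to be enumerated by `ℕ`.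
  have hK : ∀ i, Countable (K i) := fun i => (b i).countable_of_separable
  have hinf : (∀ i, ¬ FiniteDimensional ℂ (H i)) → ∀ i, Infinite (K i) := fun h i =>
    (b i).infinite_of_not_finiteDimensional (h i)
  obtain ⟨x, hxm, hxn, hx⟩ := exists_wave b ψ
  obtain ⟨D₁, A, h₁, h₂, h₃, h₄⟩ := exists_leftCanonical hN hxm hxn hx
  obtain ⟨D₂, B, h₅, h₆, h₇, h₈⟩ := exists_rightCanonical hN hxm hxn hx
  refine ⟨⟨D₁, A, h₁, h₂, h₃, fun h => h₄ (hinf h)⟩, ⟨D₂, B, h₅, h₆, h₇, fun h => h₈ (hinf h)⟩,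
    fun n h0 hn => ?_, exists_canonical hN hxm hx⟩
  obtain ⟨D, M, d, h, h'⟩ := exists_mixedCanonical hxm hx h0 hn
  exact ⟨D, M, d, h, fun hi => h' (hinf hi)⟩
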